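/- **Setting.** Let $r\ge 2$ and let $n,m\ge 1$ be coprime integers. For a finite $r$-uniform hypergraph $B$ let $R[B]$ be its set of hyperedges and $\delta(B)=n|B|-m|R[B]|$. For $A\subseteq B$ (induced substructures) write $A\le B$ if $\delta(A)\le\delta(B')$ for all $A\subseteq B'\subseteq B$, and let $\mathcal C_0$ be the class of finite $r$-uniform hypergraphs $B$ with $\emptyset\le B$. For a subset $C$ of a possibly infinite $r$-uniform hypergraph $M$ write $C\le M$ if $X\cap C\le X$ for all finite $X\subseteq M$. Let $M_0$ be the generic structure for $(\mathcal C_0,\le)$, i.e. the countable $r$-uniform hypergraph, unique up to isomorphism, such that all finite substructures of $M_0$ are in $\mathcal C_0$; $M_0$ is the union of a chain of finite substructures $F\le M_0$; and whenever $X\le M_0$ is finite and $X\le A\in\mathcal C_0$, there is an embedding $\alpha:A\to M_0$ which is the identity on $X$ and satisfies $\alpha(A)\le M_0$. For finite $X,Y\subseteq M_0$ let ${\rm cl}_0(X)$ be the smallest (finite) set with $X\subseteq {\rm cl}_0(X)\le M_0$, and let $d(X)=\delta({\rm cl}_0(X))$ and $d(X/Y)=d(X\cup Y)-d(Y)$.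 For arbitrary $Z\subseteq M_0$ let $d(X/Z)=\min\{d(X/Y): Y\subseteq Z\text{ finite}\}$ and ${\rm cl}^d(Z)=\{a\in M_0: d(a/Z)=0\}$. Let $\mathcal X=\{{\rm cl}^d(X): X\subseteq M_0\text{ finite}\}$. For $Z\subseteq M_0$ let ${\rm Aut}(M_0/Z)$ be the group of automorphisms of $M_0$ fixing every element of $Z$. For $A\in\mathcal X$, an element $b\in M_0$ is *basic over $A$* if $b\notin A$ and, for all $C\in\mathcal X$ with $A\subseteq C$ and $d(b/C)<d(b/A)$, we have $b\in C$. An automorphism $h$ of $M_0$ is *unbounded over $A\in\mathcal X$* if for all $C\in\mathcal X$ with $A\subseteq C$ and all $b$ basic over $C$ there is $b'$ in the ${\rm Aut}(M_0/C)$-orbit of $b$ with $d(hb'/C\cup\{b'\})=d(hb'/C)$. It is *bounded* if it is not unbounded over any $A\in\mathcal X$. **Theorem.** Suppose that either $r=2$ and $n>m$, or $r\ge 3$ and $n\ge m$. If $g\in{\rm Aut}(M_0/{\rm cl}^d(\emptyset))$ is bounded, then $g$ is the identity. -/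

import Mathlib

/-- An `r`-uniform hypergraph on `V`: the set `R[V]` of hyperedges is a set of `r`-element subsets
of `V` (a symmetric `r`-ary relation holding only of tuples with distinct entries). -/
structure UHypergraph (r : ℕ) (V : Type*) where
  edges : Set (Finset V)
  card_edge : ∀ e ∈ edges, e.card = r

namespace UHypergraph

section Basics

variable {r : ℕ} {V W : Type*}

/-- The (induced) substructure on a subset `X`. -/
def induce (H : UHypergraph r V) (X : Set V) : UHypergraph r X where
  edges := {e | e.map (Function.Embedding.subtype (· ∈ X)) ∈ H.edges}
  card_edge e he := by simpa using H.card_edge _ he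

/-- An embedding of structures: an injective map preserving and reflecting hyperedges. -/
def IsEmbedding (H : UHypergraph r V) (K : UHypergraph r W) (f : V ↪ W) : Prop :=
  ∀ e : Finset V, e.map f ∈ K.edges ↔ e ∈ H.edges

/-- The automorphism group `Aut(H)`, as a group of permutations of the vertices. -/
def aut (H : UHypergraph r V) : Subgroup (Equiv.Perm V) where
  carrier := {g | H.IsEmbedding H g.toEmbedding}
  one_mem' e := by
    have h : (1 : Equiv.Perm V).toEmbedding = Function.Embedding.refl V := rfl
    rw [h, Finset.map_refl]
  mul_mem' {g h} hg hh e := by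
    have hgh : (g * h).toEmbedding = h.toEmbedding.trans g.toEmbedding := rfl
    rw [hgh, ← Finset.map_map, hg, hh]
  inv_mem' {g} hg e := by
    rw [← hg, Finset.map_map]
    have h : g⁻¹.toEmbedding.trans g.toEmbedding = Function.Embedding.refl V := by
      ext x
      simp
    rw [h, Finset.map_refl]

/-- `Aut(H/X)`: the automorphisms fixing every element of `X`. -/
def autFixing (H : UHypergraph r V) (X : Set V) : Subgroup (Equiv.Perm V) where
  carrier := {g | g ∈ H.aut ∧ ∀ x ∈ X, g x = x}
  one_mem' := ⟨H.aut.one_mem, fun _ _ => rfl⟩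
  mul_mem' {g h} hg hh :=
    ⟨H.aut.mul_mem hg.1 hh.1, fun x hx => by
      rw [Equiv.Perm.mul_apply, hh.2 x hx, hg.2 x hx]⟩
  inv_mem' {g} hg :=
    ⟨H.aut.inv_mem hg.1, fun x hx => by
      rw [Equiv.Perm.inv_eq_iff_eq, hg.2 x hx]⟩

/-- `orb(b/X)`: the `Aut(H/X)`-orbit of `b`. -/
def orb (H : UHypergraph r V) (X : Set V) (b : V) : Set V :=
  {b' | ∃ k ∈ H.autFixing X, k b = b'}

/-- The predimension `δ(X) = n |X| - m |R[X]|` of the substructure on a finite set `X`.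
(It is only meaningful, and only used, for finite `X`.) -/
noncomputable def delta (H : UHypergraph r V) (n m : ℕ) (X : Set V) : ℤ :=
  n * X.ncard - m * {e | e ∈ H.edges ∧ (e : Set V) ⊆ X}.ncard

/-- `A ≤ B` for finite substructures: `δ(A) ≤ δ(B')` whenever `A ⊆ B' ⊆ B`. -/
def StrongIn (H : UHypergraph r V) (n m : ℕ) (A B : Set V) : Prop :=
  A ⊆ B ∧ ∀ B' : Set V, A ⊆ B' → B' ⊆ B → H.delta n m A ≤ H.delta n m B'

/-- `C ≤ H` for an arbitrary subset `C` of `H`: `X ∩ C ≤ X` for all finite `X ⊆ H`. -/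
def IsStrong (H : UHypergraph r V) (n m : ℕ) (C : Set V) : Prop :=
  ∀ X : Set V, X.Finite → H.StrongIn n m (X ∩ C) X

/-- Every finite substructure `B` of `H` satisfies `∅ ≤ B`. For finite `H` this is membership in
the class `𝒞₀`. -/
def InC0 (H : UHypergraph r V) (n m : ℕ) : Prop :=
  ∀ B : Set V, B.Finite → H.StrongIn n m ∅ B

/-- `H` is a generic structure for `(𝒞₀, ≤)`: it is countable, all its finite substructures are in
`𝒞₀`, it is the union of a chain of finite `≤`-substructures, and whenever `X ≤ H` is finite
and `X ≤ A ∈ 𝒞₀` (the inclusion of `X` in `A` being given as an embedding `f`), there is an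
embedding of `A` in `H` which is the identity on `X` and has image `≤ H`. These properties determine
`H` up to isomorphism. -/
structure IsGeneric (H : UHypergraph r V) (n m : ℕ) : Prop where
  countable : Countable V
  inC0 : H.InC0 n m
  chain : ∃ F : ℕ → Set V, Monotone F ∧ (∀ i, (F i).Finite ∧ H.IsStrong n m (F i)) ∧
    (⋃ i, F i) = Set.univ
  extension : ∀ X : Set V, X.Finite → H.IsStrong n m X →
    ∀ (A : Type) [Finite A] (K : UHypergraph r A), K.InC0 n m →
    ∀ f : X ↪ A, (H.induce X).IsEmbedding K f → K.IsStrong n m (Set.range f) →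
      ∃ α : A ↪ V, K.IsEmbedding H α ∧ (∀ x : X, α (f x) = x) ∧ H.IsStrong n m (Set.range α)

/-- `cl₀(X)`: the smallest `Y` with `X ⊆ Y ≤ H`. -/
def cl0 (H : UHypergraph r V) (n m : ℕ) (X : Set V) : Set V :=
  ⋂₀ {Y | X ⊆ Y ∧ H.IsStrong n m Y}

/-- The dimension `d(X) = δ(cl₀(X))` of a finite set `X`. -/
noncomputable def dim (H : UHypergraph r V) (n m : ℕ) (X : Set V) : ℤ :=
  H.delta n m (H.cl0 n m X)

/-- The relative dimension `d(X/Z)` of a finite set `X` over an arbitrary set `Z`: the minimum of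
`d(X ∪ Y) - d(Y)` over all finite `Y ⊆ Z`. -/
noncomputable def relDim (H : UHypergraph r V) (n m : ℕ) (X Z : Set V) : ℤ :=
  sInf {k | ∃ Y : Set V, Y.Finite ∧ Y ⊆ Z ∧ k = H.dim n m (X ∪ Y) - H.dim n m Y}

/-- The `d`-closure `cl^d(Z) = {a | d(a/Z) = 0}`. -/
def dcl (H : UHypergraph r V) (n m : ℕ) (Z : Set V) : Set V :=
  {a | H.relDim n m {a} Z = 0}

/-- `𝒳`: the set of `d`-closures of finite sets. -/
def closures (H : UHypergraph r V) (n m : ℕ) : Set (Set V) :=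
  {A | ∃ X : Set V, X.Finite ∧ A = H.dcl n m X}

/-- `d`-independence of the elements `a` and `c` over the set `B`: `d(a/Bc) = d(a/B)`. -/
def Indep (H : UHypergraph r V) (n m : ℕ) (a : V) (B : Set V) (c : V) : Prop :=
  H.relDim n m {a} (B ∪ {c}) = H.relDim n m {a} B

/-- `b` is basic over `A` (where `A ∈ 𝒳`). -/
def IsBasic (H : UHypergraph r V) (n m : ℕ) (b : V) (A : Set V) : Prop :=
  b ∉ A ∧ ∀ C ∈ H.closures n m, A ⊆ C →
    H.relDim n m {b} C < H.relDim n m {b} A → b ∈ C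

/-- `h` is unbounded over `A` (where `A ∈ 𝒳`). -/
def UnboundedOver (H : UHypergraph r V) (n m : ℕ) (h : Equiv.Perm V) (A : Set V) : Prop :=
  ∀ C ∈ H.closures n m, A ⊆ C → ∀ b : V, H.IsBasic n m b C →
    ∃ b' ∈ H.orb C b, H.Indep n m (h b') C b'

/-- `h` is bounded: it is not unbounded over any `A ∈ 𝒳`. -/
def IsBounded (H : UHypergraph r V) (n m : ℕ) (h : Equiv.Perm V) : Prop :=
  ¬ ∃ A ∈ H.closures n m, H.UnboundedOver n m h A

end Basics

end UHypergraph

/-! The proof turns boundedness into a rigid configuration: a hyperedge that `g` must map to itself.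

Controlled points. Failure of unboundedness gives a finite `X` and a point `b`, basic over
`cl^d(X)`, such that `g b'` depends on `b'` over `X` for every conjugate `b'` of `b`. Basicness
sharpens this to `b' ∈ cl^d(X, g b')`. Over a set `Z` absorbing the translates of `X` under `g` and
its inverse, a dimension count reverses the dependence: some `s ∉ cl^d(Z)` has `g s' ∈ cl^d(Z, s')`
for all conjugates `s'` of `s` over `cl^d(Z)` (`IsGeneric.exists_controlled`).

Raising the dimension. Points dependent on finitely many controlled points are called reached.
Attaching `m` new points by `n` hyperedges to independent copies of a reached point `y` adds
predimension `nm - mn = 0`, so the new points are reached. The hyperedges are spread evenly along a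
chain and `n`, `m` are coprime, so one end of the chain has larger dimension over `Z` than `y`, as
long as `d(y/Z) ≤ m` and `n ≥ 2` (`IsGeneric.climb_step`). Iteration gives a reached `y` with `(r -
1) d(y/Z) > m` (`IsGeneric.exists_reached`).

The rigid hyperedge. For large finite `W`, a hyperedge `e` can join one point `x`, still generic
over `W`, to `r - 1` independent copies of `y` (`IsGeneric.exists_generic_edge`). All generic points
over `W` are conjugate, so any of them can serve as `x`, with the copies moreover independent from
`g x`. Put `x`, `g x` and `W` into a strong set `A`, and the copies, their controlling points and
the `g`-images of both into a set `U`. Because of control, `U` has no more dimension than the copies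
with their controlling points, and the amalgam of `A` and `U` has room for exactly one crossing
hyperedge. Both `e` and `g e` cross, so they coincide, and then `g x = x`
(`IsGeneric.apply_eq_of_genericPoint`).

From generic points to all. A point `a` can be joined by a hyperedge to `r - 1` new points of higher
dimension over `W`. By induction on codimension these are fixed, and `a` is recovered from them
through the hyperedge (`IsGeneric.eq_one_of_fix_generic`).

The automorphisms used come from homogeneity over the infinite sets `cl^d(Z)`
(`PartialAut.exists_autFixing`) and from free amalgamation (`IsGeneric.exists_indep`). -/

namespace UHypergraph

/-! ### Submodularity of the predimension, and strong finite sets. -/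

section Predimension

variable {r : ℕ} {V W : Type*}

open Classical in
/-- The hyperedges contained in a finite set. -/
noncomputable def edgesIn (H : UHypergraph r V) (X : Finset V) : Finset (Finset V) :=
  X.powerset.filter (· ∈ H.edges)

lemma mem_edgesIn {H : UHypergraph r V} {X e : Finset V} :
    e ∈ H.edgesIn X ↔ e ⊆ X ∧ e ∈ H.edges := by
  simp [edgesIn]

/-- The predimension of a finite set of vertices, as a function on `Finset V`. -/
noncomputable def pd (H : UHypergraph r V) (n m : ℕ) (X : Finset V) : ℤ :=
  n * (X.card : ℤ) - m * ((H.edgesIn X).card : ℤ)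

variable (H : UHypergraph r V) (n m : ℕ)

lemma delta_coe (X : Finset V) : H.delta n m (X : Set V) = H.pd n m X := by
  have : {e : Finset V | e ∈ H.edges ∧ (e : Set V) ⊆ (X : Set V)} = (H.edgesIn X : Set _) := by
    ext e
    simp [mem_edgesIn, and_comm]
  rw [delta, pd, this, Set.ncard_coe_finset, Set.ncard_coe_finset]

/-- The hyperedges of `X ∪ Y` contained neither in `X` nor in `Y`. -/
noncomputable def crossing [DecidableEq V] (X Y : Finset V) : Finset (Finset V) :=
  (H.edgesIn (X ∪ Y)).filter (fun e => ¬ e ⊆ X ∧ ¬ e ⊆ Y)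

variable {H} in
lemma mem_crossing [DecidableEq V] {X Y e : Finset V} :
    e ∈ H.crossing X Y ↔ e ∈ H.edges ∧ e ⊆ X ∪ Y ∧ ¬ e ⊆ X ∧ ¬ e ⊆ Y := by
  simp only [crossing, Finset.mem_filter, mem_edgesIn]
  tauto

/-- Inclusion–exclusion for vertices and for hyperedges; the crossing hyperedges are the exact
defect of modularity. Keeping the defect as a term is what later allows crossing hyperedges to be
counted from dimensions. -/
lemma pd_union [DecidableEq V] (X Y : Finset V) :
    H.pd n m (X ∪ Y) + H.pd n m (X ∩ Y) + m * ((H.crossing X Y).card : ℤ)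
      = H.pd n m X + H.pd n m Y := by
  have h1 : (H.edgesIn (X ∪ Y)) = (H.edgesIn X ∪ H.edgesIn Y) ∪ H.crossing X Y := by
    ext e
    simp only [Finset.mem_union, mem_edgesIn, mem_crossing]
    constructor
    · tauto
    · rintro ((⟨h, h'⟩ | ⟨h, h'⟩) | h)
      · exact ⟨h.trans Finset.subset_union_left, h'⟩
      · exact ⟨h.trans Finset.subset_union_right, h'⟩
      · tauto
  have h2 : Disjoint (H.edgesIn X ∪ H.edgesIn Y) (H.crossing X Y) := by
    rw [Finset.disjoint_left]
    intro e
    simp only [Finset.mem_union, mem_edgesIn, mem_crossing]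
    tauto
  have h3 : H.edgesIn (X ∩ Y) = H.edgesIn X ∩ H.edgesIn Y := by
    ext e
    simp only [Finset.mem_inter, mem_edgesIn, Finset.subset_inter_iff]
    tauto
  have h4 := Finset.card_union_add_card_inter (H.edgesIn X) (H.edgesIn Y)
  have h5 := Finset.card_union_add_card_inter X Y
  have h6 : (H.edgesIn (X ∪ Y)).card
      = (H.edgesIn X ∪ H.edgesIn Y).card + (H.crossing X Y).card := by
    rw [h1, Finset.card_union_of_disjoint h2]
  simp only [pd, h3, h6]
  push_cast
  zify at h4 h5
  linear_combination (n : ℤ) * h5 - (m : ℤ) * h4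

lemma pd_submodular [DecidableEq V] (X Y : Finset V) :
    H.pd n m (X ∪ Y) + H.pd n m (X ∩ Y) ≤ H.pd n m X + H.pd n m Y := by
  have := H.pd_union n m X Y
  have h : (0 : ℤ) ≤ m * ((H.crossing X Y).card : ℤ) := by positivity
  linarith

/-- A finite set is strong if intersecting with it does not increase the predimension. -/
def FinStrong [DecidableEq V] (S : Finset V) : Prop :=
  ∀ B : Finset V, H.pd n m (B ∩ S) ≤ H.pd n m B

variable {H n m}

lemma finStrong_iff [DecidableEq V] {S : Finset V} :
    H.FinStrong n m S ↔ ∀ B, S ⊆ B → H.pd n m S ≤ H.pd n m B := by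
  constructor
  · intro h B hB
    have := h B
    rwa [Finset.inter_eq_right.2 hB] at this
  · intro h B
    have h1 := H.pd_submodular n m B S
    have h2 := h (B ∪ S) Finset.subset_union_right
    linarith

lemma isStrong_iff [DecidableEq V] {C : Set V} [DecidablePred (· ∈ C)] :
    H.IsStrong n m C ↔ ∀ B : Finset V, H.pd n m (B.filter (· ∈ C)) ≤ H.pd n m B := by
  constructor
  · intro h B
    have := (h B B.finite_toSet).2 B Set.inter_subset_left le_rfl
    rw [← delta_coe, ← delta_coe]
    convert this using 2
    ext x
    simp
  · intro h X hX
    refine ⟨Set.inter_subset_left, fun B' h1 h2 => ?_⟩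
    lift B' to Finset V using hX.subset h2
    have h3 : X ∩ C = ((B'.filter (· ∈ C) : Finset V) : Set V) := by
      ext x
      simp only [Set.mem_inter_iff, Finset.coe_filter, Set.mem_ofPred_eq]
      exact ⟨fun hx => ⟨h1 hx, hx.2⟩, fun hx => ⟨h2 hx.1, hx.2⟩⟩
    rw [h3, delta_coe, delta_coe]
    exact h B'

lemma isStrong_coe [DecidableEq V] {S : Finset V} :
    H.IsStrong n m (S : Set V) ↔ H.FinStrong n m S := by
  classical
  rw [isStrong_iff]
  refine forall_congr' fun B => ?_
  have : B.filter (· ∈ (S : Set V)) = B ∩ S := by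
    ext x; simp
  rw [this]

lemma pd_empty (hr : r ≠ 0) : H.pd n m ∅ = 0 := by
  have : H.edgesIn ∅ = ∅ := by
    ext e
    simp only [mem_edgesIn, Finset.subset_empty, Finset.notMem_empty, iff_false]
    rintro ⟨rfl, h⟩
    exact hr (by simpa using (H.card_edge _ h).symm)
  simp [pd, this]

lemma inC0_iff (hr : r ≠ 0) : H.InC0 n m ↔ ∀ B : Finset V, 0 ≤ H.pd n m B := by
  have h0 : H.delta n m ∅ = 0 := by
    have := H.delta_coe n m ∅
    rwa [Finset.coe_empty, pd_empty hr] at this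
  constructor
  · intro h B
    have h2 := (h B B.finite_toSet).2 B (Set.empty_subset _) le_rfl
    rwa [h0, delta_coe] at h2
  · intro h B hB
    refine ⟨Set.empty_subset _, fun B' _ h2 => ?_⟩
    lift B' to Finset V using hB.subset h2
    rw [h0, delta_coe]
    exact h B'

end Predimension

/-! ### The dimension as a submodular rank function, and its closure operator. -/

section Rank

variable {r : ℕ} {V : Type*} (H : UHypergraph r V) (n m : ℕ)

/-- The dimension of a finite set, as a function on `Finset V`. -/
noncomputable def rk (X : Finset V) : ℤ := H.dim n m (X : Set V)

/-- The class of structures all of whose finite subsets have nonnegative predimension. -/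
def Nonneg : Prop := ∀ B : Finset V, 0 ≤ H.pd n m B

variable {H n m}

lemma Nonneg.exists_min (h0 : H.Nonneg n m) (X : Finset V) :
    ∃ S, X ⊆ S ∧ ∀ B, X ⊆ B → H.pd n m S ≤ H.pd n m B := by
  let f : {S : Finset V // X ⊆ S} → ℕ := fun S => (H.pd n m S).toNat
  have : Nonempty {S : Finset V // X ⊆ S} := ⟨⟨X, le_rfl⟩⟩
  obtain ⟨S, hS⟩ : ∃ S, ∀ B, f S ≤ f B := ⟨Function.argmin f, fun B => Function.argmin_le f B⟩
  refine ⟨S, S.2, fun B hB => ?_⟩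
  have := hS ⟨B, hB⟩
  have h1 := h0 S
  have h2 := h0 B
  simp only [f] at this
  omega

variable [DecidableEq V]

lemma FinStrong.inter {S T : Finset V} (hS : H.FinStrong n m S) (hT : H.FinStrong n m T) :
    H.FinStrong n m (S ∩ T) := fun B => by
  rw [← Finset.inter_assoc]
  exact (hT _).trans (hS _)

/-- `cl₀(X)` is finite, and `d(X)` is the minimal predimension of the finite supersets. -/
lemma Nonneg.exists_cl0 (h0 : H.Nonneg n m) (X : Finset V) :
    ∃ S : Finset V, X ⊆ S ∧ H.FinStrong n m S ∧ H.pd n m S = H.rk n m X ∧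
      (∀ B, X ⊆ B → H.pd n m S ≤ H.pd n m B) ∧
      (∀ T, X ⊆ T → H.FinStrong n m T → S ⊆ T) := by
  classical
  obtain ⟨T, hXT, hT⟩ := h0.exists_min X
  have hTs : H.FinStrong n m T := finStrong_iff.2 fun B hB => hT B (hXT.trans hB)
  -- Strong sets are closed under intersection, so a strong superset of least cardinality is the
  -- least one.
  have hex : ∃ k, ∃ S : Finset V, X ⊆ S ∧ H.FinStrong n m S ∧ S.card = k := ⟨_, T, hXT, hTs, rfl⟩
  obtain ⟨S, hXS, hS, hk⟩ := Nat.find_spec hex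
  have hmin : ∀ R, X ⊆ R → H.FinStrong n m R → S ⊆ R := by
    intro R hR hRs
    have h1 := Nat.find_min' hex ⟨S ∩ R, Finset.subset_inter hXS hR, hS.inter hRs, rfl⟩
    rw [← hk] at h1
    exact Finset.inter_eq_left.1 (Finset.eq_of_subset_of_card_le Finset.inter_subset_left h1)
  have hcl : H.cl0 n m (X : Set V) = S := by
    apply subset_antisymm
    · exact Set.sInter_subset_of_mem ⟨by exact_mod_cast hXS, isStrong_coe.2 hS⟩
    · apply Set.subset_sInter
      rintro Y ⟨hXY, hY⟩
      have : H.FinStrong n m (S.filter (· ∈ Y)) := by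
        intro B
        have h1 := isStrong_iff.1 hY (B ∩ S)
        have h2 : B ∩ S.filter (· ∈ Y) = (B ∩ S).filter (· ∈ Y) := by
          ext x; simp [and_assoc]
        rw [h2]
        exact h1.trans (hS B)
      have h3 := hmin _ (fun x hx => by
        rw [Finset.mem_filter]; exact ⟨hXS hx, hXY (by exact_mod_cast hx)⟩) this
      intro x hx
      exact (Finset.mem_filter.1 (h3 hx)).2
  have hST := hmin T hXT hTs
  have hle : H.pd n m S ≤ H.pd n m T := by
    have := hS T
    rwa [Finset.inter_eq_right.2 hST] at this
  refine ⟨S, hXS, hS, ?_, fun B hB => hle.trans (hT B hB), hmin⟩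
  rw [rk, dim, hcl, delta_coe]

lemma Nonneg.rk_le (h0 : H.Nonneg n m) {X Y : Finset V} (h : X ⊆ Y) :
    H.rk n m X ≤ H.pd n m Y := by
  obtain ⟨S, -, -, h1, h2, -⟩ := h0.exists_cl0 X
  exact h1 ▸ h2 Y h

lemma Nonneg.le_rk (h0 : H.Nonneg n m) {X : Finset V} {k : ℤ}
    (h : ∀ Y, X ⊆ Y → k ≤ H.pd n m Y) : k ≤ H.rk n m X := by
  obtain ⟨S, h3, -, h1, h2, -⟩ := h0.exists_cl0 X
  exact h1 ▸ h S h3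

lemma Nonneg.rk_mono (h0 : H.Nonneg n m) {X Y : Finset V} (h : X ⊆ Y) :
    H.rk n m X ≤ H.rk n m Y :=
  h0.le_rk fun _ hZ => h0.rk_le (h.trans hZ)

lemma Nonneg.rk_nonneg (h0 : H.Nonneg n m) (X : Finset V) : 0 ≤ H.rk n m X :=
  h0.le_rk fun Y _ => h0 Y

lemma Nonneg.rk_submod (h0 : H.Nonneg n m) (X Y : Finset V) :
    H.rk n m (X ∪ Y) + H.rk n m (X ∩ Y) ≤ H.rk n m X + H.rk n m Y := by
  obtain ⟨S, hS, -, h1, -⟩ := h0.exists_cl0 X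
  obtain ⟨T, hT, -, h2, -⟩ := h0.exists_cl0 Y
  have h3 := h0.rk_le (Finset.union_subset_union hS hT)
  have h4 := h0.rk_le (Finset.inter_subset_inter hS hT)
  have h5 := H.pd_submodular n m S T
  linarith

/-- Submodularity with a common subset in place of the intersection. -/
lemma Nonneg.rk_submod' (h0 : H.Nonneg n m) {X Y Z U : Finset V} (hU : U ⊆ X ∪ Y) (hX : Z ⊆ X)
    (hY : Z ⊆ Y) : H.rk n m U + H.rk n m Z ≤ H.rk n m X + H.rk n m Y := by
  have h1 := h0.rk_submod X Y
  have h2 := h0.rk_mono (Finset.subset_inter hX hY)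
  have h3 := h0.rk_mono hU
  linarith

lemma Nonneg.finStrong_iff_rk (h0 : H.Nonneg n m) {S : Finset V} :
    H.FinStrong n m S ↔ H.rk n m S = H.pd n m S := by
  rw [finStrong_iff]
  constructor
  · intro h
    exact le_antisymm (h0.rk_le le_rfl) (h0.le_rk h)
  · intro h B hB
    rw [← h]
    exact h0.rk_le hB

/-- The relative dimension over a set `Z` with finite subset `W` of which every element of `Z` is
dependent. -/
lemma Nonneg.relDim_eq (h0 : H.Nonneg n m) {X W : Finset V} {Z : Set V} (hWZ : (W : Set V) ⊆ Z)
    (hZ : ∀ Y : Finset V, (Y : Set V) ⊆ Z → H.rk n m (W ∪ Y) = H.rk n m W) :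
    H.relDim n m X Z = H.rk n m (X ∪ W) - H.rk n m W := by
  rw [relDim]
  refine IsLeast.csInf_eq ⟨⟨W, W.finite_toSet, hWZ, ?_⟩, ?_⟩
  · rw [rk, rk, Finset.coe_union]
  · rintro k ⟨Y, hY, hYZ, rfl⟩
    lift Y to Finset V using hY
    -- Replacing `Y` by `W ∪ Y` can only lower the relative dimension, and `W ∪ Y` has the same rank
    -- as `W`; so the minimum is attained at `W`.
    have h1 := hZ Y hYZ
    have h2 := h0.rk_submod' (X := X ∪ Y) (Y := W ∪ Y) (Z := Y) (U := X ∪ W)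
      (by intro x; simp; tauto) Finset.subset_union_right Finset.subset_union_right
    have h3 : H.dim n m (↑X ∪ ↑Y) = H.rk n m (X ∪ Y) := by rw [rk, Finset.coe_union]
    have h4 : H.dim n m ↑Y = H.rk n m Y := rfl
    rw [h3, h4]
    linarith

lemma Nonneg.relDim_coe (h0 : H.Nonneg n m) (X Z : Finset V) :
    H.relDim n m X Z = H.rk n m (X ∪ Z) - H.rk n m Z :=
  h0.relDim_eq le_rfl fun Y hY => by
    rw [Finset.union_eq_left.2 (by exact_mod_cast hY)]

lemma Nonneg.mem_dcl (h0 : H.Nonneg n m) {a : V} {Z : Finset V} :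
    a ∈ H.dcl n m (Z : Set V) ↔ H.rk n m (insert a Z) = H.rk n m Z := by
  have := h0.relDim_coe {a} Z
  rw [Finset.coe_singleton, Finset.singleton_union] at this
  rw [dcl, Set.mem_ofPred_eq, this, sub_eq_zero]

lemma Nonneg.subset_dcl (h0 : H.Nonneg n m) (Z : Finset V) : (Z : Set V) ⊆ H.dcl n m (Z : Set V) :=
  fun a ha => by
    rw [h0.mem_dcl, Finset.insert_eq_of_mem (by exact_mod_cast ha)]

lemma Nonneg.rk_union_of_subset_dcl (h0 : H.Nonneg n m) {Z Y : Finset V}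
    (h : (Y : Set V) ⊆ H.dcl n m (Z : Set V)) (X : Finset V) :
    H.rk n m (Z ∪ X ∪ Y) = H.rk n m (Z ∪ X) := by
  induction Y using Finset.induction_on with
  | empty => simp
  | insert a Y ha ih =>
    rw [Finset.coe_insert, Set.insert_subset_iff] at h
    have h1 := ih h.2
    have h2 := h0.mem_dcl.1 h.1
    have h3 := h0.rk_submod' (X := Z ∪ X ∪ Y) (Y := insert a Z) (Z := Z)
      (U := Z ∪ X ∪ insert a Y) (by intro x; simp; tauto) (by intro x; simp; tauto)
      (Finset.subset_insert _ _)
    have h4 := h0.rk_mono (X := Z ∪ X) (Y := Z ∪ X ∪ insert a Y) Finset.subset_union_left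
    linarith

lemma Nonneg.subset_dcl_iff (h0 : H.Nonneg n m) {Z Y : Finset V} :
    (Y : Set V) ⊆ H.dcl n m (Z : Set V) ↔ H.rk n m (Z ∪ Y) = H.rk n m Z := by
  constructor
  · intro h
    simpa using h0.rk_union_of_subset_dcl h ∅
  · intro h a ha
    rw [h0.mem_dcl]
    refine le_antisymm ?_ (h0.rk_mono (Finset.subset_insert _ _))
    rw [← h]
    apply h0.rk_mono
    intro x; simp only [Finset.mem_insert, Finset.mem_union]
    rintro (rfl | hx)
    · exact Or.inr (by exact_mod_cast ha)
    · exact Or.inl hx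

lemma Nonneg.relDim_dcl (h0 : H.Nonneg n m) (X Z : Finset V) :
    H.relDim n m X (H.dcl n m (Z : Set V)) = H.rk n m (X ∪ Z) - H.rk n m Z :=
  h0.relDim_eq (h0.subset_dcl Z) fun _ hY => h0.subset_dcl_iff.1 hY

lemma Nonneg.dcl_mono (h0 : H.Nonneg n m) {Z Y : Finset V}
    (h : (Z : Set V) ⊆ H.dcl n m (Y : Set V)) :
    H.dcl n m (Z : Set V) ⊆ H.dcl n m (Y : Set V) := by
  intro a ha
  have h1 := h0.mem_dcl.1 ha
  have h2 := h0.subset_dcl_iff.1 h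
  rw [h0.mem_dcl]
  have h3 := h0.rk_submod' (X := Y ∪ Z) (Y := insert a Z) (Z := Z)
      (U := insert a Y) (by intro x; simp; tauto) (by intro x; simp; tauto)
      (Finset.subset_insert _ _)
  have h4 := h0.rk_mono (X := Y) (Y := insert a Y) (Finset.subset_insert _ _)
  linarith

lemma Nonneg.dcl_mono_of_subset (h0 : H.Nonneg n m) {Z Y : Finset V} (h : Z ⊆ Y) :
    H.dcl n m (Z : Set V) ⊆ H.dcl n m (Y : Set V) :=
  h0.dcl_mono (subset_trans (by exact_mod_cast h) (h0.subset_dcl Y))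

/-- The trace of a `d`-closed set on a strong set is strong. -/
lemma Nonneg.finStrong_filter_dcl (h0 : H.Nonneg n m) {E Z : Finset V} (hE : H.FinStrong n m E)
    (hZ : Z ⊆ E) [DecidablePred (· ∈ H.dcl n m (Z : Set V))] :
    H.FinStrong n m (E.filter (· ∈ H.dcl n m (Z : Set V))) := by
  set E0 := E.filter (· ∈ H.dcl n m (Z : Set V)) with hE0
  have hZE0 : Z ⊆ E0 := fun x hx => Finset.mem_filter.2
    ⟨hZ hx, h0.subset_dcl Z (by exact_mod_cast hx)⟩
  have hr : H.rk n m E0 = H.rk n m Z := by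
    have : H.rk n m (Z ∪ E0) = H.rk n m Z := h0.subset_dcl_iff.1 fun x hx => by
      rw [Finset.mem_coe, hE0, Finset.mem_filter] at hx
      exact hx.2
    rwa [Finset.union_eq_right.2 hZE0] at this
  -- The strong closure of the trace stays inside `E` and has the rank of `Z`, so it lies in the
  -- `d`-closure and adds nothing to the trace.
  obtain ⟨S, h1, h2, h3, h4, h5⟩ := h0.exists_cl0 E0
  have hSE : S ⊆ E := h5 E (Finset.filter_subset _ _) hE
  have : S = E0 := by
    refine subset_antisymm (fun x hx => ?_) h1
    rw [hE0, Finset.mem_filter]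
    refine ⟨hSE hx, (h0.subset_dcl_iff (Y := S)).2 ?_ (by exact_mod_cast hx)⟩
    rw [Finset.union_eq_right.2 (hZE0.trans h1)]
    rw [← hr, ← h3]
    exact le_antisymm (h0.rk_le le_rfl) (h3 ▸ h0.rk_mono h1)
  rw [← this]
  exact h2

end Rank

/-! ### Partial isomorphisms and invariance of the dimension. -/

section Isomorphisms

variable {r : ℕ} {V W : Type*}

/-- `f` restricts to an isomorphism from the substructure of `K` on `B` to that of `H` on `f(B)`. -/
structure IsoOn [DecidableEq V] (K : UHypergraph r W) (H : UHypergraph r V) (f : W → V)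
    (B : Finset W) : Prop where
  injOn : Set.InjOn f B
  edges_iff : ∀ e ⊆ B, e.image f ∈ H.edges ↔ e ∈ K.edges

variable {K : UHypergraph r W} {H : UHypergraph r V} {n m : ℕ} [DecidableEq V]

lemma IsoOn.congr {f f' : W → V} {B : Finset W} (h : IsoOn K H f B) (hf : ∀ x ∈ B, f' x = f x) :
    IsoOn K H f' B := by
  refine ⟨fun x hx y hy hxy => h.injOn hx hy ?_, fun e he => ?_⟩
  · rwa [← hf x hx, ← hf y hy]
  · rw [← h.edges_iff e he, Finset.image_congr (fun x hx => hf x (he hx))]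

lemma IsoOn.pd_image {f : W → V} {B : Finset W} (h : IsoOn K H f B) {T : Finset W} (hT : T ⊆ B) :
    H.pd n m (T.image f) = K.pd n m T := by
  have h1 : (H.edgesIn (T.image f)) = (K.edgesIn T).image (fun e => e.image f) := by
    ext e
    simp only [mem_edgesIn, Finset.mem_image]
    constructor
    · rintro ⟨h1, h2⟩
      obtain ⟨e', he', rfl⟩ := Finset.subset_image_iff.1 h1
      have he' : e' ⊆ T := by exact_mod_cast he'
      exact ⟨e', ⟨he', (h.edges_iff _ (he'.trans hT)).1 h2⟩, rfl⟩
    · rintro ⟨e', ⟨he', h2⟩, rfl⟩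
      exact ⟨Finset.image_subset_image he', (h.edges_iff _ (he'.trans hT)).2 h2⟩
  have h2 : Set.InjOn (fun e : Finset W => e.image f) (K.edgesIn T : Set (Finset W)) := by
    intro e he e' he' hee
    have he1 := (mem_edgesIn.1 (Finset.mem_coe.1 he)).1.trans hT
    have he2 := (mem_edgesIn.1 (Finset.mem_coe.1 he')).1.trans hT
    rw [← Finset.coe_inj] at hee ⊢
    simp only [Finset.coe_image] at hee
    exact (h.injOn.image_eq_image_iff (by exact_mod_cast he1) (by exact_mod_cast he2)).1 hee
  rw [pd, pd, h1, Finset.card_image_of_injOn h2,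
    Finset.card_image_of_injOn (h.injOn.mono (by exact_mod_cast hT))]

lemma isoOn_of_mem_aut {g : Equiv.Perm V} (hg : g ∈ H.aut) (B : Finset V) : IsoOn H H g B := by
  refine ⟨g.injective.injOn, fun e _ => ?_⟩
  rw [← hg e, Finset.map_eq_image]
  rfl

lemma pd_image_aut {g : Equiv.Perm V} (hg : g ∈ H.aut) (B : Finset V) :
    H.pd n m (B.image g) = H.pd n m B :=
  (isoOn_of_mem_aut hg B).pd_image le_rfl

lemma Nonneg.rk_image_aut_le (h0 : H.Nonneg n m) {g : Equiv.Perm V} (hg : g ∈ H.aut)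
    (B : Finset V) : H.rk n m (B.image g) ≤ H.rk n m B :=
  h0.le_rk fun Y hY => pd_image_aut (n := n) (m := m) hg Y ▸ h0.rk_le (Finset.image_subset_image hY)

lemma Nonneg.rk_image_aut (h0 : H.Nonneg n m) {g : Equiv.Perm V} (hg : g ∈ H.aut)
    (B : Finset V) : H.rk n m (B.image g) = H.rk n m B := by
  refine le_antisymm (h0.rk_image_aut_le hg B) ?_
  have := h0.rk_image_aut_le (H.aut.inv_mem hg) (B.image g)
  rw [Finset.image_image] at this
  have h : (⇑g⁻¹ ∘ ⇑g) = id := by ext; simp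
  rwa [h, Finset.image_id] at this

lemma Nonneg.mem_dcl_image (h0 : H.Nonneg n m) {g : Equiv.Perm V} (hg : g ∈ H.aut) {a : V}
    {Z : Finset V} :
    g a ∈ H.dcl n m ((Z.image g : Finset V) : Set V) ↔ a ∈ H.dcl n m (Z : Set V) := by
  rw [h0.mem_dcl, h0.mem_dcl, ← Finset.image_insert, h0.rk_image_aut hg, h0.rk_image_aut hg]

/-- Isomorphisms between strong sets preserve dimension. -/
lemma Nonneg.rk_image_le (h0 : H.Nonneg n m) {f : V → V} {E X : Finset V}
    (hf : IsoOn H H f E) (hE : H.FinStrong n m E) (hX : X ⊆ E) :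
    H.rk n m (X.image f) ≤ H.rk n m X := by
  refine h0.le_rk fun Y hY => ?_
  refine le_trans ?_ (hE Y)
  rw [← hf.pd_image Finset.inter_subset_right]
  exact h0.rk_le (Finset.image_subset_image (Finset.subset_inter hY hX))

lemma IsoOn.symm {f : V → W} [DecidableEq W] [Nonempty V] {E : Finset V} (hf : IsoOn H K f E) :
    IsoOn K H (Function.invFunOn f E) (E.image f) ∧
      (E.image f).image (Function.invFunOn f E) = E := by
  have hinv : ∀ x ∈ E, Function.invFunOn f (E : Set V) (f x) = x := fun x hx =>
    hf.injOn.leftInvOn_invFunOn (by exact_mod_cast hx)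
  refine ⟨⟨?_, ?_⟩, ?_⟩
  · intro x hx y hy hxy
    simp only [Finset.coe_image, Set.mem_image] at hx hy
    obtain ⟨x, hx, rfl⟩ := hx
    obtain ⟨y, hy, rfl⟩ := hy
    rw [hinv x hx, hinv y hy] at hxy
    rw [hxy]
  · intro e he
    obtain ⟨e', he', rfl⟩ := Finset.subset_image_iff.1 he
    have he' : e' ⊆ E := by exact_mod_cast he'
    rw [hf.edges_iff _ he', Finset.image_image]
    have : e'.image (Function.invFunOn f (E : Set V) ∘ f) = e' := by
      conv_rhs => rw [← Finset.image_id (s := e')]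
      exact Finset.image_congr fun x hx => hinv x (he' hx)
    rw [this]
  · rw [Finset.image_image]
    conv_rhs => rw [← Finset.image_id (s := E)]
    exact Finset.image_congr fun x hx => hinv x hx

lemma Nonneg.rk_image (h0 : H.Nonneg n m) {f : V → V} {E X : Finset V}
    (hf : IsoOn H H f E) (hE : H.FinStrong n m E) (hE' : H.FinStrong n m (E.image f))
    (hX : X ⊆ E) : H.rk n m (X.image f) = H.rk n m X := by
  refine le_antisymm (h0.rk_image_le hf hE hX) ?_
  rcases isEmpty_or_nonempty V with hV | hV
  · rw [Finset.eq_empty_of_isEmpty X, Finset.image_empty]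
  have h1 := h0.rk_image_le hf.symm.1 hE' (Finset.image_subset_image hX)
  rw [Finset.image_image] at h1
  have : X.image (Function.invFunOn f (E : Set V) ∘ f) = X := by
    conv_rhs => rw [← Finset.image_id (s := X)]
    exact Finset.image_congr fun x hx =>
      hf.injOn.leftInvOn_invFunOn (by exact_mod_cast hX hx)
  rwa [this] at h1

end Isomorphisms

/-! ### The extension property for finite subsets of an arbitrary hypergraph. -/

section Extension

variable {r : ℕ} {V W : Type*} {H : UHypergraph r V} {n m : ℕ}

lemma pd_comap {A : Type*} [DecidableEq W] {K : UHypergraph r W} {K' : UHypergraph r A} (j : A ↪ W)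
    (hj : ∀ e, e ∈ K'.edges ↔ e.map j ∈ K.edges) (T : Finset A) :
    K'.pd n m T = K.pd n m (T.map j) := by
  have : IsoOn K' K j T := ⟨j.injective.injOn, fun e _ => by rw [hj, Finset.map_eq_image]⟩
  rw [Finset.map_eq_image, this.pd_image le_rfl]

/-- The extension property of the generic structure, with the structure to be embedded given as a
finite subset `B` of some hypergraph `K`. -/
lemma IsGeneric.extend [DecidableEq V] [DecidableEq W] [Nonempty V] (hH : H.IsGeneric n m)
    (hr : r ≠ 0) {K : UHypergraph r W} {B : Finset W} {X : Finset V} (hX : H.FinStrong n m X)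
    {f : V → W} (hfB : X.image f ⊆ B) (hf : IsoOn H K f X)
    (hs : ∀ T ⊆ B, K.pd n m (T ∩ X.image f) ≤ K.pd n m T) :
    ∃ α : W → V, IsoOn K H α B ∧ (∀ x ∈ X, α (f x) = x) ∧ H.FinStrong n m (B.image α) := by
  have h0 : H.Nonneg n m := (inC0_iff hr).1 hH.inC0
  let ε : B ≃ Fin B.card := B.equivFin
  let j : Fin B.card ↪ W := ε.symm.toEmbedding.trans (Function.Embedding.subtype _)
  have hjB : ∀ i, j i ∈ B := fun i => (ε.symm i).2
  have hjε : ∀ w (hw : w ∈ B), j (ε ⟨w, hw⟩) = w := fun w hw => by simp [j]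
  let K' : UHypergraph r (Fin B.card) :=
    ⟨{e | e.map j ∈ K.edges}, fun e he => by simpa using K.card_edge _ he⟩
  have hK' : ∀ e, e ∈ K'.edges ↔ e.map j ∈ K.edges := fun e => Iff.rfl
  have hmapB : ∀ T : Finset (Fin B.card), T.map j ⊆ B := fun T x hx => by
    rw [Finset.mem_map] at hx
    obtain ⟨i, -, rfl⟩ := hx
    exact hjB i
  let f' : (X : Set V) ↪ Fin B.card :=
    ⟨fun x => ε ⟨f x, hfB (Finset.mem_image_of_mem f x.2)⟩, fun x y hxy => by
      have := ε.injective hxy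
      rw [Subtype.mk.injEq] at this
      exact Subtype.ext (hf.injOn x.2 y.2 this)⟩
  have hjf' : ∀ x, j (f' x) = f x := fun x => hjε _ _
  have hC0 : K'.InC0 n m := (inC0_iff hr).2 fun T => by
    rw [pd_comap j hK']
    refine le_trans ?_ (hs _ (hmapB T))
    obtain ⟨Y, hY, hYe⟩ := Finset.subset_image_iff.1
      (Finset.inter_subset_right : T.map j ∩ X.image f ⊆ X.image f)
    rw [← hYe, hf.pd_image (by exact_mod_cast hY)]
    exact h0 Y
  have hemb : (H.induce (X : Set V)).IsEmbedding K' f' := by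
    intro e
    rw [hK', Finset.map_map]
    have h1 : e.map (f'.trans j) = (e.map (Function.Embedding.subtype (· ∈ (X : Set V)))).image f := by
      ext w
      simp only [Finset.mem_map, Finset.mem_image, Function.Embedding.trans_apply, hjf']
      simp
    rw [h1, hf.edges_iff _ (fun x hx => by
      rw [Finset.mem_map] at hx
      obtain ⟨y, -, rfl⟩ := hx
      exact y.2)]
    rfl
  have hstr : K'.IsStrong n m (Set.range f') := by
    classical
    rw [isStrong_iff]
    intro T
    rw [pd_comap j hK', pd_comap j hK']
    refine le_of_eq_of_le ?_ (hs _ (hmapB T))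
    congr 1
    ext w
    simp only [Finset.mem_map, Finset.mem_filter, Set.mem_range, Finset.mem_inter,
      Finset.mem_image]
    constructor
    · rintro ⟨i, ⟨hi, x, rfl⟩, rfl⟩
      exact ⟨⟨_, hi, rfl⟩, x, x.2, (hjf' x).symm⟩
    · rintro ⟨⟨i, hi, rfl⟩, x, hx, hxi⟩
      refine ⟨i, ⟨hi, ⟨x, hx⟩, j.injective ?_⟩, rfl⟩
      rw [hjf', hxi]
  obtain ⟨α', h1, h2, h3⟩ := hH.extension X X.finite_toSet (isStrong_coe.2 hX) (Fin B.card) K' hC0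
    f' hemb hstr
  let α : W → V := fun w => if hw : w ∈ B then α' (ε ⟨w, hw⟩) else Classical.arbitrary V
  have hα : ∀ i, α (j i) = α' i := fun i => by
    have : ε ⟨j i, hjB i⟩ = i := j.injective (hjε _ _)
    simp only [α, hjB i, dif_pos, this]
  have hsurj : ∀ w ∈ B, ∃ i, j i = w := fun w hw => ⟨_, hjε w hw⟩
  refine ⟨α, ⟨?_, ?_⟩, ?_, ?_⟩
  · intro x hx y hy hxy
    obtain ⟨i, rfl⟩ := hsurj x hx
    obtain ⟨k, rfl⟩ := hsurj y hy
    rw [hα, hα] at hxy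
    rw [α'.injective hxy]
  · intro e he
    obtain ⟨e', rfl⟩ : ∃ e' : Finset (Fin B.card), e'.map j = e := by
      refine ⟨Finset.univ.filter (fun i => j i ∈ e), ?_⟩
      ext w
      simp only [Finset.mem_map, Finset.mem_filter, Finset.mem_univ, true_and]
      constructor
      · rintro ⟨i, hi, rfl⟩
        exact hi
      · intro hw
        obtain ⟨i, rfl⟩ := hsurj w (he hw)
        exact ⟨i, hw, rfl⟩
    rw [← hK', ← h1]
    have : (e'.map j).image α = e'.map α' := by
      ext v
      simp [hα]
    rw [this]
  · intro x hx
    have := hjf' ⟨x, hx⟩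
    rw [← this, hα]
    exact h2 ⟨x, hx⟩
  · rw [← isStrong_coe]
    convert h3 using 1
    ext v
    simp only [Finset.coe_image, Set.mem_image, Finset.mem_coe, Set.mem_range]
    constructor
    · rintro ⟨w, hw, rfl⟩
      obtain ⟨i, rfl⟩ := hsurj w hw
      exact ⟨i, (hα i).symm⟩
    · rintro ⟨i, rfl⟩
      exact ⟨j i, hjB i, hα i⟩

end Extension

/-! ### Back-and-forth over the `d`-closure of a finite set. -/

section Homogeneity

variable {r : ℕ} {V : Type*} {H : UHypergraph r V} {n m : ℕ} [DecidableEq V]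

/-- A strong set `D ⊇ Z` is freely amalgamated with every strong subset of `cl^d(Z)` that
contains `Z`, and the union is strong. -/
lemma Nonneg.free_over_dcl (h0 : H.Nonneg n m) (hm : 1 ≤ m) {Z D F : Finset V}
    (hD : H.FinStrong n m D) (hF : H.FinStrong n m F) (hZD : Z ⊆ D) (hZF : Z ⊆ F)
    (hFZ : (F : Set V) ⊆ H.dcl n m (Z : Set V)) :
    H.FinStrong n m (D ∪ F) ∧ H.crossing D F = ∅ := by
  have h1 := H.pd_union n m D F
  have h2 := h0.rk_le (le_refl (D ∪ F))
  have h3 := h0.rk_mono (Finset.subset_union_left : D ⊆ D ∪ F)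
  rw [h0.finStrong_iff_rk] at hD hF ⊢
  have h4 : H.rk n m F = H.rk n m Z := by
    have := h0.subset_dcl_iff.1 hFZ
    rwa [Finset.union_eq_right.2 hZF] at this
  have h5 := (h0.rk_le (Finset.subset_inter hZD hZF))
  have h6 : (0 : ℤ) ≤ m * ((H.crossing D F).card : ℤ) := by positivity
  refine ⟨by linarith, ?_⟩
  have h7 : (m : ℤ) * ((H.crossing D F).card : ℤ) = 0 := by linarith
  have : m ≠ 0 := by omega
  simpa [this] using h7

/-- Finite partial automorphisms between strong sets, fixing `cl^d(Z)` pointwise. -/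
structure PartialAut (H : UHypergraph r V) (n m : ℕ) (Z E : Finset V) (f : V → V) : Prop where
  subset : Z ⊆ E
  strong : H.FinStrong n m E
  strong_image : H.FinStrong n m (E.image f)
  iso : IsoOn H H f E
  fix : ∀ x ∈ E, x ∈ H.dcl n m (Z : Set V) → f x = x

variable {Z E : Finset V} {f : V → V}

lemma PartialAut.image_base (h0 : H.Nonneg n m) (h : PartialAut H n m Z E f) : Z.image f = Z := by
  conv_rhs => rw [← Finset.image_id (s := Z)]
  exact Finset.image_congr fun x hx =>
    h.fix x (h.subset hx) (h0.subset_dcl Z hx)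

/-- Isomorphisms of strong sets preserve dimension and `Z` is fixed, so `f x` depends on `Z` only if
`x` does. -/
lemma PartialAut.fix_of_apply (h0 : H.Nonneg n m) (h : PartialAut H n m Z E f) {x : V}
    (hx : x ∈ E) (hfx : f x ∈ H.dcl n m (Z : Set V)) : f x = x := by
  refine h.fix x hx ?_
  rw [h0.mem_dcl] at hfx ⊢
  rw [← h0.rk_image h.iso h.strong h.strong_image (Finset.insert_subset hx h.subset),
    Finset.image_insert, h.image_base h0, hfx]

lemma PartialAut.symm (h0 : H.Nonneg n m) [Nonempty V] (h : PartialAut H n m Z E f) :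
    PartialAut H n m Z (E.image f) (Function.invFunOn f E) := by
  refine ⟨?_, h.strong_image, ?_, h.iso.symm.1, ?_⟩
  · exact (h.image_base h0).symm.subset.trans (Finset.image_subset_image h.subset)
  · rw [h.iso.symm.2]
    exact h.strong
  · intro y hy hyZ
    obtain ⟨x, hx, rfl⟩ := Finset.mem_image.1 hy
    rw [h.iso.injOn.leftInvOn_invFunOn hx, h.fix_of_apply h0 hx hyZ]

/-- By `Nonneg.free_over_dcl` no hyperedge crosses between `F` and either `E` or `f(E)`, so gluing
`f` to the identity on `F` creates and destroys no hyperedge. -/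
lemma PartialAut.union_fixed (h0 : H.Nonneg n m) (hm : 1 ≤ m) (h : PartialAut H n m Z E f)
    {F : Finset V} (hF : H.FinStrong n m F) (hZF : Z ⊆ F)
    (hFZ : (F : Set V) ⊆ H.dcl n m (Z : Set V)) :
    PartialAut H n m Z (E ∪ F) (fun x => if x ∈ E then f x else x) := by
  set f1 : V → V := fun x => if x ∈ E then f x else x with hf1
  have hE : ∀ x ∈ E, f1 x = f x := fun x hx => by simp [hf1, hx]
  have hFid : ∀ x ∈ F, f1 x = x := fun x hx => by
    by_cases hxE : x ∈ E
    · rw [hE x hxE, h.fix x hxE (hFZ hx)]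
    · simp [hf1, hxE]
  have hback : ∀ x ∈ E, f x ∈ F → f x = x := fun x hx hxF => h.fix_of_apply h0 hx (hFZ hxF)
  have himE : E.image f1 = E.image f := Finset.image_congr hE
  have himF : F.image f1 = F := by
    conv_rhs => rw [← Finset.image_id (s := F)]
    exact Finset.image_congr hFid
  have hZE' : Z ⊆ E.image f :=
    (h.image_base h0).symm.subset.trans (Finset.image_subset_image h.subset)
  obtain ⟨hs, hc⟩ := h0.free_over_dcl hm h.strong hF h.subset hZF hFZ
  obtain ⟨hs', hc'⟩ := h0.free_over_dcl hm h.strong_image hF hZE' hZF hFZ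
  refine ⟨h.subset.trans Finset.subset_union_left, hs, ?_, ⟨?_, ?_⟩, ?_⟩
  · rwa [Finset.image_union, himE, himF]
  · intro x hx y hy hxy
    rw [Finset.mem_coe, Finset.mem_union] at hx hy
    by_cases hxE : x ∈ E <;> by_cases hyE : y ∈ E
    · rw [hE x hxE, hE y hyE] at hxy
      exact h.iso.injOn hxE hyE hxy
    · rw [hE x hxE, hFid y (by tauto)] at hxy
      rw [← hxy, hback x hxE (by rw [hxy]; tauto)]
    · rw [hFid x (by tauto), hE y hyE] at hxy
      rw [hxy, hback y hyE (by rw [← hxy]; tauto)]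
    · rwa [hFid x (by tauto), hFid y (by tauto)] at hxy
  · intro e he
    by_cases heE : e ⊆ E
    · rw [Finset.image_congr (fun x hx => hE x (heE hx)), h.iso.edges_iff e heE]
    by_cases heF : e ⊆ F
    · rw [Finset.image_congr (g := id) (fun x hx => hFid x (heF hx)), Finset.image_id]
    have n1 : e ∉ H.edges := fun hee => by
      have : e ∈ H.crossing E F := mem_crossing.2 ⟨hee, he, heE, heF⟩
      rw [hc] at this
      exact Finset.notMem_empty _ this
    have n2 : e.image f1 ∉ H.edges := fun hee => by
      have : e.image f1 ∈ H.crossing (E.image f) F := by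
        refine mem_crossing.2 ⟨hee, ?_, fun hsub => heE fun x hx => ?_,
          fun hsub => heF fun x hx => ?_⟩
        · exact (Finset.image_subset_image he).trans_eq (by rw [Finset.image_union, himE, himF])
        · by_contra hxE
          have hxF : x ∈ F := (Finset.mem_union.1 (he hx)).resolve_left hxE
          have := hsub (Finset.mem_image_of_mem _ hx)
          rw [hFid x hxF] at this
          obtain ⟨y, hy, hyx⟩ := Finset.mem_image.1 this
          rw [hback y hy (hyx ▸ hxF)] at hyx
          exact hxE (hyx ▸ hy)
        · by_cases hxE : x ∈ E
          · have := hsub (Finset.mem_image_of_mem _ hx)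
            rw [hE x hxE] at this
            rwa [hback x hxE this] at this
          · exact (Finset.mem_union.1 (he hx)).resolve_left hxE
      rw [hc'] at this
      exact Finset.notMem_empty _ this
    simp [n1, n2]
  · intro x hx hxZ
    by_cases hxE : x ∈ E
    · rw [hE x hxE, h.fix x hxE hxZ]
    · exact hFid x ((Finset.mem_union.1 hx).resolve_left hxE)

/-- The inverse of `f` presents `F` as a strong extension of `f(E)`, to which the extension property
applies. The points of `F` that must stay fixed are already in `E`, so the embedding need not
respect any further constraint. -/
lemma PartialAut.extend_of_trace (hH : H.IsGeneric n m) (hr : r ≠ 0) [Nonempty V]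
    (h : PartialAut H n m Z E f) {F : Finset V} (hEF : E ⊆ F) (hF : H.FinStrong n m F)
    (htr : ∀ x ∈ F, x ∈ H.dcl n m (Z : Set V) → x ∈ E) :
    ∃ f', PartialAut H n m Z F f' ∧ ∀ x ∈ E, f' x = f x := by
  obtain ⟨h1, h2⟩ := h.iso.symm
  obtain ⟨α, ha, hb, hc⟩ := hH.extend hr (K := H) (B := F) h.strong_image
    (f := Function.invFunOn f E) (by rw [h2]; exact hEF) h1
    (fun T _ => by rw [h2]; exact h.strong T)
  have hα : ∀ x ∈ E, α x = f x := fun x hx => by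
    have := hb (f x) (Finset.mem_image_of_mem f hx)
    rwa [h.iso.injOn.leftInvOn_invFunOn hx] at this
  exact ⟨α, ⟨h.subset.trans hEF, hF, hc, ha, fun x hx hxZ => by
    rw [hα x (htr x hx hxZ), h.fix x (htr x hx hxZ) hxZ]⟩, hα⟩

lemma PartialAut.extend (hH : H.IsGeneric n m) (hr : r ≠ 0) (hm : 1 ≤ m) [Nonempty V]
    (h : PartialAut H n m Z E f) (e : Finset V) :
    ∃ F f', PartialAut H n m Z F f' ∧ E ⊆ F ∧ e ⊆ F ∧ ∀ x ∈ E, f' x = f x := by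
  classical
  have h0 : H.Nonneg n m := (inC0_iff hr).1 hH.inC0
  -- The domain is first enlarged by the identity on the trace of `cl^d(Z)` on `F`; only then are
  -- the remaining points of `F` embedded.
  obtain ⟨F, hF, hFs, -⟩ := h0.exists_cl0 (E ∪ e)
  rw [Finset.union_subset_iff] at hF
  have hZF := h.subset.trans hF.1
  have h1 := h0.finStrong_filter_dcl hFs hZF
  have h2 := h.union_fixed h0 hm h1
    (fun x hx => Finset.mem_filter.2 ⟨hZF hx, h0.subset_dcl Z hx⟩)
    (fun x hx => (Finset.mem_filter.1 hx).2)
  obtain ⟨f', h3, h4⟩ := h2.extend_of_trace hH hr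
    (Finset.union_subset hF.1 (Finset.filter_subset _ _)) hFs
    (fun x hx hxZ => Finset.mem_union_right _ (Finset.mem_filter.2 ⟨hx, hxZ⟩))
  refine ⟨F, f', h3, hF.1, hF.2, fun x hx => ?_⟩
  rw [h4 x (Finset.mem_union_left _ hx)]
  simp [hx]

lemma PartialAut.extend_symm (hH : H.IsGeneric n m) (hr : r ≠ 0) (hm : 1 ≤ m) [Nonempty V]
    (h : PartialAut H n m Z E f) (e : Finset V) :
    ∃ F f', PartialAut H n m Z F f' ∧ E ⊆ F ∧ e ⊆ F.image f' ∧ ∀ x ∈ E, f' x = f x := by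
  have h0 : H.Nonneg n m := (inC0_iff hr).1 hH.inC0
  obtain ⟨F, f', h1, h2, h3, h4⟩ := (h.symm h0).extend hH hr hm e
  have hE : ∀ x ∈ E, f' (f x) = x := fun x hx => by
    rw [h4 _ (Finset.mem_image_of_mem f hx), h.iso.injOn.leftInvOn_invFunOn hx]
  have hsub : E ⊆ F.image f' := fun x hx =>
    Finset.mem_image.2 ⟨f x, h2 (Finset.mem_image_of_mem f hx), hE x hx⟩
  refine ⟨_, _, h1.symm h0, hsub, ?_, fun x hx => ?_⟩
  · rw [h1.iso.symm.2]
    exact h3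
  · conv_lhs => rw [← hE x hx]
    exact h1.iso.injOn.leftInvOn_invFunOn (h2 (Finset.mem_image_of_mem f hx))

/-- Homogeneity: an isomorphism between finite strong sets that fixes the points of `cl^d(Z)`
extends to an automorphism fixing `cl^d(Z)` pointwise. -/
theorem PartialAut.exists_autFixing (hH : H.IsGeneric n m) (hr : r ≠ 0) (hm : 1 ≤ m)
    (h : PartialAut H n m Z E f) :
    ∃ k ∈ H.autFixing (H.dcl n m (Z : Set V)), ∀ x ∈ E, k x = f x := by
  rcases isEmpty_or_nonempty V with hV | hV
  · exact ⟨1, one_mem _, fun x => isEmptyElim x⟩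
  have := hH.countable
  have := Encodable.ofCountable V
  let P := {p : Finset V × (V → V) // PartialAut H n m Z p.1 p.2}
  let _ : Preorder P :=
    { le := fun p q => p.1.1 ⊆ q.1.1 ∧ ∀ x ∈ p.1.1, q.1.2 x = p.1.2 x
      le_refl := fun p => ⟨le_rfl, fun _ _ => rfl⟩
      le_trans := fun p q s h1 h2 => ⟨h1.1.trans h2.1, fun x hx => by
        rw [h2.2 x (h1.1 hx), h1.2 x hx]⟩ }
  -- For each finite `e`, the partial automorphisms with `e` in both domain and range are cofinal.
  -- Since there are countably many finite sets, an ideal meeting all these families exists, and its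
  -- union is a total bijection.
  let 𝒟 : Finset V → Order.Cofinal P := fun e =>
    { carrier := {p | e ⊆ p.1.1 ∧ e ⊆ p.1.1.image p.1.2}
      isCofinal := fun p => by
        obtain ⟨F, f', h1, h2, h3, h4⟩ := p.2.extend hH hr hm e
        obtain ⟨G, f'', h5, h6, h7, h8⟩ := h1.extend_symm hH hr hm e
        exact ⟨⟨(G, f''), h5⟩, ⟨h3.trans h6, h7⟩, h2.trans h6, fun x hx => by
          rw [← h4 x hx]; exact h8 x (h2 hx)⟩ }
  let p0 : P := ⟨(E, f), h⟩
  let I := Order.idealOfCofinals p0 𝒟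
  have hp0 : p0 ∈ I := Order.mem_idealOfCofinals p0 𝒟
  have hI : ∀ e : Finset V, ∃ p ∈ I, e ⊆ p.1.1 ∧ e ⊆ p.1.1.image p.1.2 := fun e => by
    obtain ⟨p, h1, h2⟩ := Order.cofinal_meets_idealOfCofinals p0 𝒟 e
    exact ⟨p, h2, h1⟩
  choose p hpI hp1 hp2 using hI
  let k : V → V := fun v => (p {v}).1.2 v
  have hk : ∀ q ∈ I, ∀ x ∈ q.1.1, k x = q.1.2 x := by
    intro q hq x hx
    obtain ⟨s, hs, h1, h2⟩ := I.directed _ (hpI {x}) q hq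
    rw [← h2.2 x hx, h1.2 x (hp1 {x} (Finset.mem_singleton_self x))]
  have hbij : Function.Bijective k := by
    constructor
    · intro x y hxy
      have hx := hp1 {x, y} (Finset.mem_insert_self _ _)
      have hy := hp1 {x, y} (Finset.mem_insert_of_mem (Finset.mem_singleton_self y))
      rw [hk _ (hpI {x, y}) x hx, hk _ (hpI {x, y}) y hy] at hxy
      exact (p {x, y}).2.iso.injOn hx hy hxy
    · intro y
      obtain ⟨x, hx, hxy⟩ := Finset.mem_image.1 (hp2 {y} (Finset.mem_singleton_self y))
      exact ⟨x, by rw [hk _ (hpI {y}) x hx, hxy]⟩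
  refine ⟨Equiv.ofBijective k hbij, ⟨fun e => ?_, fun x hx => ?_⟩, fun x hx => ?_⟩
  · rw [← (p e).2.iso.edges_iff e (hp1 e), Finset.map_eq_image]
    rw [Finset.image_congr (g := (p e).1.2)]
    exact fun x hx => hk _ (hpI e) x (hp1 e hx)
  · exact (p {x}).2.fix x (hp1 {x} (Finset.mem_singleton_self x)) hx
  · exact hk p0 hp0 x hx

end Homogeneity

/-! ### Adjoining new points with prescribed hyperedges to a strong set. -/

section Adjoin

lemma image_disjSum_elim {V N : Type*} [DecidableEq V] (β : N → V) (P : Finset V) (Y : Finset N) :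
    (P.disjSum Y).image (Sum.elim id β) = P ∪ Y.image β := by
  ext x
  simp only [Finset.mem_image, Finset.mem_disjSum, Finset.mem_union]
  constructor
  · rintro ⟨-, ⟨y, hy, rfl⟩ | ⟨y, hy, rfl⟩, rfl⟩
    · exact Or.inl hy
    · exact Or.inr ⟨y, hy, rfl⟩
  · rintro (h | ⟨y, hy, rfl⟩)
    · exact ⟨Sum.inl x, Or.inl ⟨x, h, rfl⟩, rfl⟩
    · exact ⟨Sum.inr y, Or.inr ⟨y, hy, rfl⟩, rfl⟩

variable {r : ℕ} {V N : Type*} {H : UHypergraph r V} {n m : ℕ} [DecidableEq V] [DecidableEq N]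

/-- The hypergraph on `V ⊕ N` consisting of `H` and a finite set of further hyperedges. -/
def addEdges (H : UHypergraph r V) (𝓕 : Finset (Finset (V ⊕ N))) (hc : ∀ ε ∈ 𝓕, ε.card = r) :
    UHypergraph r (V ⊕ N) where
  edges := {e | e ∈ 𝓕 ∨ ∃ e₀ ∈ H.edges, e = e₀.map Function.Embedding.inl}
  card_edge := by
    rintro e (he | ⟨e₀, he, rfl⟩)
    · exact hc e he
    · rw [Finset.card_map]
      exact H.card_edge _ he

lemma pd_addEdges {𝓕 : Finset (Finset (V ⊕ N))} (hc : ∀ ε ∈ 𝓕, ε.card = r)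
    (hright : ∀ ε ∈ 𝓕, ∃ b, Sum.inr b ∈ ε) (P : Finset V) (Y : Finset N) :
    (H.addEdges 𝓕 hc).pd n m (P.disjSum Y)
      = H.pd n m P + n * (Y.card : ℤ) - m * ((𝓕.filter (· ⊆ P.disjSum Y)).card : ℤ) := by
  have h1 : (H.addEdges 𝓕 hc).edgesIn (P.disjSum Y)
      = 𝓕.filter (· ⊆ P.disjSum Y)
        ∪ (H.edgesIn P).map (Finset.mapEmbedding Function.Embedding.inl).toEmbedding := by
    ext e
    simp only [mem_edgesIn, addEdges, Set.mem_ofPred_eq, Finset.mem_union, Finset.mem_filter,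
      Finset.mem_map, RelEmbedding.coe_toEmbedding, Finset.mapEmbedding_apply]
    constructor
    · rintro ⟨h1, h2 | ⟨e₀, h3, rfl⟩⟩
      · exact Or.inl ⟨h2, h1⟩
      · refine Or.inr ⟨e₀, ⟨fun x hx => ?_, h3⟩, rfl⟩
        simpa using h1 (Finset.mem_map_of_mem Function.Embedding.inl hx)
    · rintro (⟨h1, h2⟩ | ⟨e₀, ⟨h3, h4⟩, rfl⟩)
      · exact ⟨h2, Or.inl h1⟩
      · refine ⟨fun x hx => ?_, Or.inr ⟨e₀, h4, rfl⟩⟩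
        obtain ⟨y, hy, rfl⟩ := Finset.mem_map.1 hx
        simpa using h3 hy
  have h2 : Disjoint (𝓕.filter (· ⊆ P.disjSum Y))
      ((H.edgesIn P).map (Finset.mapEmbedding Function.Embedding.inl).toEmbedding) := by
    rw [Finset.disjoint_left]
    intro e he he'
    obtain ⟨b, hb⟩ := hright e (Finset.mem_filter.1 he).1
    obtain ⟨e₀, -, rfl⟩ := Finset.mem_map.1 he'
    simp at hb
  rw [pd, pd, h1, Finset.card_union_of_disjoint h2, Finset.card_map, Finset.card_disjSum]
  push_cast
  ring

/-- `β(R)` is a set of new points adjoined to `D` in `H`, the hyperedges of `D ∪ β(R)` not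
contained in `D` being given by `𝓕`. -/
structure Adjoined (H : UHypergraph r V) (n m : ℕ) (D : Finset V) (R : Finset N)
    (𝓕 : Finset (Finset (V ⊕ N))) (β : N → V) : Prop where
  injOn : Set.InjOn β R
  notMem : ∀ b ∈ R, β b ∉ D
  strong : H.FinStrong n m (D ∪ R.image β)
  edges_iff : ∀ e ⊆ D.disjSum R, e.image (Sum.elim id β) ∈ H.edges ↔
    e ∈ 𝓕 ∨ ∃ e₀ ∈ H.edges, e = e₀.map Function.Embedding.inl
  pd_eq : ∀ P ⊆ D, ∀ Y ⊆ R, H.pd n m (P ∪ Y.image β)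
    = H.pd n m P + n * (Y.card : ℤ) - m * ((𝓕.filter (· ⊆ P.disjSum Y)).card : ℤ)

/-- The hypothesis `hneg` bounds the hyperedges supported on each set of new points, whatever old
points they use. Hence deleting the new points never raises the predimension, which is what makes
`D` strong in the enlarged structure. -/
lemma IsGeneric.adjoin [Nonempty V] (hH : H.IsGeneric n m) (hr : r ≠ 0) {D : Finset V}
    (hD : H.FinStrong n m D) (R : Finset N) (𝓕 : Finset (Finset (V ⊕ N)))
    (hc : ∀ ε ∈ 𝓕, ε.card = r) (hright : ∀ ε ∈ 𝓕, ∃ b, Sum.inr b ∈ ε)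
    (hneg : ∀ Y ⊆ R, (m : ℤ) * ((𝓕.filter (fun ε => ε.toRight ⊆ Y)).card : ℤ)
      ≤ n * (Y.card : ℤ)) :
    ∃ β : N → V, Adjoined H n m D R 𝓕 β := by
  set K := H.addEdges 𝓕 hc with hK
  have himD : D.image Sum.inl = D.disjSum (∅ : Finset N) := by
    ext x; simp [eq_comm]
  obtain ⟨α, h1, h2, h3⟩ := hH.extend hr (K := K) (B := D.disjSum R) hD (f := Sum.inl)
    (by rw [himD]; exact Finset.disjSum_mono le_rfl (Finset.empty_subset _))
    (by
      refine ⟨Sum.inl_injective.injOn, fun e he => ?_⟩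
      have he' : e.image Sum.inl = e.map (Function.Embedding.inl : V ↪ V ⊕ N) := by
        rw [Finset.map_eq_image]; rfl
      rw [he', hK]
      constructor
      · rintro (h | ⟨e₀, h4, h5⟩)
        · obtain ⟨b, hb⟩ := hright _ h
          simp at hb
        · rwa [Finset.map_injective _ h5]
      · exact fun h => Or.inr ⟨e, h, rfl⟩)
    (by
      intro T hT
      obtain ⟨P, Y, rfl⟩ : ∃ P Y, T = Finset.disjSum P Y :=
        ⟨_, _, (Finset.toLeft_disjSum_toRight (u := T)).symm⟩
      have hP : P ⊆ D := fun x hx => by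
        simpa using hT (Finset.inl_mem_disjSum.2 hx)
      have hY : Y ⊆ R := fun x hx => by
        simpa using hT (Finset.inr_mem_disjSum.2 hx)
      have hint : P.disjSum Y ∩ D.disjSum (∅ : Finset N) = P.disjSum ∅ := by
        ext (x | x)
        · simpa using fun hx => hP hx
        · simp
      rw [himD, hint, pd_addEdges hc hright, pd_addEdges hc hright]
      have h1 := hneg Y hY
      have h2 : ((𝓕.filter (· ⊆ P.disjSum Y)).card : ℤ)
          ≤ ((𝓕.filter (fun ε => ε.toRight ⊆ Y)).card : ℤ) := by
        have : 𝓕.filter (· ⊆ P.disjSum Y) ⊆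
            𝓕.filter (fun ε => ε.toRight ⊆ Y) := fun ε hε => by
          rw [Finset.mem_filter] at hε ⊢
          exact ⟨hε.1, fun b hb => by
            simpa using hε.2 (Finset.mem_toRight.1 hb)⟩
        exact_mod_cast Finset.card_le_card this
      have h3 : (0 : ℤ) ≤ m * ((𝓕.filter (· ⊆ P.disjSum (∅ : Finset N))).card : ℤ) := by
        positivity
      have h4 := mul_le_mul_of_nonneg_left h2 (Int.natCast_nonneg m)
      rw [Finset.card_empty]
      push_cast
      linarith)
  have hα : ∀ x ∈ D.disjSum R, α x = Sum.elim id (α ∘ Sum.inr) x := by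
    rintro (x | x) hx
    · exact h2 x (by simpa using hx)
    · rfl
  have h4 := h1.congr (f' := Sum.elim id (α ∘ Sum.inr)) (fun x hx => (hα x hx).symm)
  refine ⟨α ∘ Sum.inr, ?_, ?_, ?_, fun e he => h4.edges_iff e he, fun P hP Y hY => ?_⟩
  · intro x hx y hy hxy
    exact Sum.inr_injective (h1.injOn (Finset.inr_mem_disjSum.2 hx)
      (Finset.inr_mem_disjSum.2 hy) hxy)
  · intro b hb hbD
    have h5 := h2 _ hbD
    have := h1.injOn (Finset.inl_mem_disjSum.2 hbD) (Finset.inr_mem_disjSum.2 hb) h5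
    simp at this
  · rw [← image_disjSum_elim]
    rwa [Finset.image_congr (fun x hx => hα x hx)] at h3
  · rw [← image_disjSum_elim, h4.pd_image (Finset.disjSum_mono hP hY), pd_addEdges hc hright]

variable {D : Finset V} {R : Finset N} {𝓕 : Finset (Finset (V ⊕ N))} {β : N → V}

/-- Since `D ∪ β(R)` is strong, a lower bound on dimension need only be tested on its subsets, where
the predimension is explicit. -/
lemma Adjoined.le_rk (h : Adjoined H n m D R 𝓕 β) (h0 : H.Nonneg n m) {U : Finset V} {k : ℤ}
    (hU : U ⊆ D ∪ R.image β)
    (hk : ∀ P ⊆ D, ∀ Y ⊆ R, U ⊆ P ∪ Y.image β →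
      k ≤ H.pd n m P + n * (Y.card : ℤ) - m * ((𝓕.filter (· ⊆ P.disjSum Y)).card : ℤ)) :
    k ≤ H.rk n m U := by
  refine h0.le_rk fun T hT => ?_
  refine le_trans ?_ (h.strong T)
  have h1 : T ∩ (D ∪ R.image β) = (T ∩ D) ∪ (R.filter (fun b => β b ∈ T)).image β := by
    ext x
    simp only [Finset.mem_inter, Finset.mem_union, Finset.mem_image, Finset.mem_filter]
    constructor
    · rintro ⟨h1, h2 | ⟨b, hb, rfl⟩⟩
      · exact Or.inl ⟨h1, h2⟩
      · exact Or.inr ⟨b, ⟨hb, h1⟩, rfl⟩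
    · rintro (⟨h1, h2⟩ | ⟨b, ⟨hb, h1⟩, rfl⟩)
      · exact ⟨h1, Or.inl h2⟩
      · exact ⟨h1, Or.inr ⟨b, hb, rfl⟩⟩
  have h2 := Finset.subset_inter hT hU
  rw [h1] at h2 ⊢
  rw [h.pd_eq _ Finset.inter_subset_right _ (Finset.filter_subset _ _)]
  exact hk _ Finset.inter_subset_right _ (Finset.filter_subset _ _) h2

lemma Adjoined.mem_of_mem_union (h : Adjoined H n m D R 𝓕 β) {P : Finset V} {Y : Finset N}
    (hP : P ⊆ D) (hY : Y ⊆ R) {b : N} (hb : b ∈ R) (hbU : β b ∈ P ∪ Y.image β) : b ∈ Y := by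
  rcases Finset.mem_union.1 hbU with h1 | h1
  · exact absurd (hP h1) (h.notMem b hb)
  · obtain ⟨c, hc, hcb⟩ := Finset.mem_image.1 h1
    rwa [← h.injOn (hY hc) hb hcb]

lemma Adjoined.mem_of_mem_union_left (h : Adjoined H n m D R 𝓕 β) {P : Finset V} {Y : Finset N}
    (hY : Y ⊆ R) {x : V} (hx : x ∈ D) (hxU : x ∈ P ∪ Y.image β) : x ∈ P := by
  rcases Finset.mem_union.1 hxU with h1 | h1
  · exact h1
  · obtain ⟨c, hc, rfl⟩ := Finset.mem_image.1 h1
    exact absurd hx (h.notMem c (hY hc))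

lemma Adjoined.image_mem_edges (h : Adjoined H n m D R 𝓕 β) {ε : Finset (V ⊕ N)}
    (hε : ε ∈ 𝓕) (hsub : ε ⊆ D.disjSum R) : ε.image (Sum.elim id β) ∈ H.edges :=
  (h.edges_iff ε hsub).2 (Or.inl hε)

lemma Adjoined.injOn_elim (h : Adjoined H n m D R 𝓕 β) :
    Set.InjOn (Sum.elim id β) (D.disjSum R : Finset (V ⊕ N)) := by
  rintro (x | x) hx (y | y) hy hxy
  · exact congrArg _ hxy
  · rw [Finset.mem_coe, Finset.inl_mem_disjSum] at hx
    rw [Finset.mem_coe, Finset.inr_mem_disjSum] at hy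
    have hxy : x = β y := hxy
    exact absurd (hxy ▸ hx) (h.notMem y hy)
  · rw [Finset.mem_coe, Finset.inr_mem_disjSum] at hx
    rw [Finset.mem_coe, Finset.inl_mem_disjSum] at hy
    have hxy : β x = y := hxy
    exact absurd (hxy ▸ hy) (h.notMem x hx)
  · rw [Finset.mem_coe, Finset.inr_mem_disjSum] at hx hy
    exact congrArg _ (h.injOn hx hy hxy)

end Adjoin

/-! ### Free amalgamation and independent conjugates. -/

section Independence

variable {r : ℕ} {V : Type*} {H : UHypergraph r V} {n m : ℕ} [DecidableEq V]

lemma image_eq_self_of_fix {k : V → V} {Z : Finset V} (h : ∀ x ∈ Z, k x = x) : Z.image k = Z := by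
  conv_rhs => rw [← Finset.image_id (s := Z)]
  exact Finset.image_congr h

/-- The free amalgam of `A` and `E` over the common strong subset `E₀` is realised in the generic
structure: there is a strong copy `f(E)` of `E` over `E₀` freely amalgamated with `A`. -/
lemma IsGeneric.exists_free_copy [Nonempty V] (hH : H.IsGeneric n m) (hr : r ≠ 0)
    {A E E₀ : Finset V} (hA : H.FinStrong n m A)
    (hE₀ : H.FinStrong n m E₀) (hE₀E : E₀ ⊆ E) (hE₀A : E₀ ⊆ A) :
    ∃ f : V → V, IsoOn H H f E ∧ (∀ x ∈ E₀, f x = x) ∧ H.FinStrong n m (E.image f) ∧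
      H.FinStrong n m (A ∪ E.image f) ∧
      H.pd n m (A ∪ E.image f) + H.pd n m E₀ = H.pd n m A + H.pd n m E := by
  have h0 : H.Nonneg n m := (inC0_iff hr).1 hH.inC0
  -- The common base stays in the old summand and the rest of `E` is duplicated in the new one; the
  -- hyperedges to adjoin are those of `E` not inside `E₀`.
  let φ : V → V ⊕ V := fun x => if x ∈ E₀ then Sum.inl x else Sum.inr x
  have hφl : ∀ x ∈ E₀, φ x = Sum.inl x := fun x hx => by simp [φ, hx]
  have hφr : ∀ x ∉ E₀, φ x = Sum.inr x := fun x hx => by simp [φ, hx]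
  have hφfold : ∀ x, Sum.elim id id (φ x) = x := fun x => by
    by_cases hx : x ∈ E₀
    · rw [hφl x hx]; rfl
    · rw [hφr x hx]; rfl
  have hφinj : Function.Injective φ := fun x y hxy => by rw [← hφfold x, hxy, hφfold]
  have hφim : Function.Injective (fun e : Finset V => e.image φ) :=
    Finset.image_injective hφinj
  set R := E \ E₀ with hR
  set 𝒢 := H.edgesIn E \ H.edgesIn E₀ with h𝒢
  set 𝓕 := 𝒢.image (fun e => e.image φ) with h𝓕
  have hmem𝒢 : ∀ e, e ∈ 𝒢 ↔ e ⊆ E ∧ e ∈ H.edges ∧ ¬ e ⊆ E₀ := fun e => by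
    simp only [h𝒢, Finset.mem_sdiff, mem_edgesIn]
    tauto
  have hinr : ∀ (e : Finset V) (b : V), Sum.inr b ∈ e.image φ ↔ b ∈ e ∧ b ∉ E₀ := by
    intro e b
    rw [Finset.mem_image]
    constructor
    · rintro ⟨x, hx, hxb⟩
      by_cases hx0 : x ∈ E₀
      · rw [hφl x hx0] at hxb
        simp at hxb
      · rw [hφr x hx0] at hxb
        rw [← Sum.inr_injective hxb]
        exact ⟨hx, hx0⟩
    · rintro ⟨h1, h2⟩
      exact ⟨b, h1, hφr b h2⟩
  have hedge : ∀ Y ⊆ R, (m : ℤ) * (((H.edgesIn (E₀ ∪ Y)) \ H.edgesIn E₀).card : ℤ)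
      = n * (Y.card : ℤ) + H.pd n m E₀ - H.pd n m (E₀ ∪ Y) := by
    intro Y hY
    have h1 : H.edgesIn E₀ ⊆ H.edgesIn (E₀ ∪ Y) := fun e he => by
      rw [mem_edgesIn] at he ⊢
      exact ⟨he.1.trans Finset.subset_union_left, he.2⟩
    have h2 : (E₀ ∪ Y).card = E₀.card + Y.card := Finset.card_union_of_disjoint (by
      rw [Finset.disjoint_right]
      exact fun x hx => (Finset.mem_sdiff.1 (hY hx)).2)
    have h3 := Finset.card_sdiff_add_card_eq_card h1
    rw [pd, pd, h2, ← h3]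
    push_cast
    ring
  have hEu : E₀ ∪ R = E := by rw [hR, Finset.union_sdiff_of_subset hE₀E]
  have hcard : (m : ℤ) * (𝓕.card : ℤ) = n * (R.card : ℤ) + H.pd n m E₀ - H.pd n m E := by
    rw [h𝓕, Finset.card_image_of_injective _ hφim]
    have := hedge R le_rfl
    rwa [hEu] at this
  have hright : ∀ ε ∈ 𝓕, ∃ b, Sum.inr b ∈ ε := by
    intro ε hε
    obtain ⟨e, he, rfl⟩ := Finset.mem_image.1 hε
    obtain ⟨b, hb, hb'⟩ := Finset.not_subset.1 ((hmem𝒢 e).1 he).2.2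
    exact ⟨b, (hinr e b).2 ⟨hb, hb'⟩⟩
  have hcr : ∀ ε ∈ 𝓕, ε.card = r := by
    intro ε hε
    obtain ⟨e, he, rfl⟩ := Finset.mem_image.1 hε
    rw [Finset.card_image_of_injective _ hφinj]
    exact H.card_edge _ ((hmem𝒢 e).1 he).2.1
  have hφE : ∀ e ⊆ E, e.image φ ⊆ E₀.disjSum R := by
    intro e he x hx
    obtain ⟨y, hy, rfl⟩ := Finset.mem_image.1 hx
    by_cases hy0 : y ∈ E₀
    · rw [hφl y hy0, Finset.inl_mem_disjSum]
      exact hy0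
    · rw [hφr y hy0, Finset.inr_mem_disjSum]
      exact Finset.mem_sdiff.2 ⟨he hy, hy0⟩
  have h𝓕sub : ∀ ε ∈ 𝓕, ε ⊆ E₀.disjSum R := by
    intro ε hε
    obtain ⟨e, he, rfl⟩ := Finset.mem_image.1 hε
    exact hφE e ((hmem𝒢 e).1 he).1
  -- The required inequality says that `E₀` is strong in `E₀ ∪ Y`.
  obtain ⟨β, hβ⟩ := hH.adjoin hr hA R 𝓕 hcr hright (by
    intro Y hY
    have h1 : 𝓕.filter (fun ε => ε.toRight ⊆ Y)
        ⊆ ((H.edgesIn (E₀ ∪ Y)) \ H.edgesIn E₀).image (fun e => e.image φ) := by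
      intro ε hε
      obtain ⟨hε1, hε2⟩ := Finset.mem_filter.1 hε
      obtain ⟨e, he, rfl⟩ := Finset.mem_image.1 hε1
      refine Finset.mem_image_of_mem _ ?_
      rw [Finset.mem_sdiff, mem_edgesIn, mem_edgesIn]
      obtain ⟨h1, h2, h3⟩ := (hmem𝒢 e).1 he
      refine ⟨⟨fun x hx => ?_, h2⟩, fun h => h3 h.1⟩
      rw [Finset.mem_union]
      by_cases hx0 : x ∈ E₀
      · exact Or.inl hx0
      · exact Or.inr (hε2 (Finset.mem_toRight.2 ((hinr e x).2 ⟨hx, hx0⟩)))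
    have h2 := Finset.card_le_card h1
    rw [Finset.card_image_of_injective _ hφim] at h2
    have h3 := hedge Y hY
    have h4 := finStrong_iff.1 hE₀ (E₀ ∪ Y) Finset.subset_union_left
    have h5 : (m : ℤ) * ((𝓕.filter (fun ε => ε.toRight ⊆ Y)).card : ℤ)
        ≤ m * (((H.edgesIn (E₀ ∪ Y)) \ H.edgesIn E₀).card : ℤ) :=
      mul_le_mul_of_nonneg_left (by exact_mod_cast h2) (Int.natCast_nonneg m)
    linarith)
  set f : V → V := fun x => Sum.elim id β (φ x) with hf
  have hfim : ∀ e : Finset V, e.image f = (e.image φ).image (Sum.elim id β) := fun e => by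
    rw [Finset.image_image]; rfl
  have hfl : ∀ x ∈ E₀, f x = x := fun x hx => by simp only [hf, hφl x hx]; rfl
  have hfr : ∀ x ∉ E₀, f x = β x := fun x hx => by simp only [hf, hφr x hx]; rfl
  have himE : E.image f = E₀ ∪ R.image β := by
    rw [← hEu, Finset.image_union, image_eq_self_of_fix hfl]
    congr 1
    exact Finset.image_congr fun x hx => hfr x (Finset.mem_sdiff.1 hx).2
  have hsubA : E₀.disjSum R ⊆ A.disjSum R := Finset.disjSum_mono hE₀A le_rfl
  have hall : ∀ P : Finset V, E₀ ⊆ P → 𝓕.filter (· ⊆ P.disjSum R) = 𝓕 := fun P hP =>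
    Finset.filter_true_of_mem fun ε hε => (h𝓕sub ε hε).trans (Finset.disjSum_mono hP le_rfl)
  have hAim : A ∪ E.image f = A ∪ R.image β := by
    rw [himE, ← Finset.union_assoc, Finset.union_eq_left.2 hE₀A]
  refine ⟨f, ⟨?_, ?_⟩, hfl, ?_, ?_, ?_⟩
  · intro x hx y hy hxy
    refine hφinj (hβ.injOn_elim (hsubA ?_) (hsubA ?_) hxy)
    · exact hφE {x} (by simpa using hx) (by simp)
    · exact hφE {y} (by simpa using hy) (by simp)
  · intro e he
    rw [hfim, hβ.edges_iff _ ((hφE e he).trans hsubA)]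
    constructor
    · rintro (h | ⟨e₀, h1, h2⟩)
      · obtain ⟨e', he', hee⟩ := Finset.mem_image.1 h
        rw [← hφim hee]
        exact ((hmem𝒢 e').1 he').2.1
      · have : e = e₀ := by
          have h3 := congrArg (Finset.image (Sum.elim id id)) h2
          rw [Finset.image_image, Finset.map_eq_image, Finset.image_image] at h3
          rwa [image_eq_self_of_fix (k := Sum.elim id id ∘ φ) (fun x _ => hφfold x),
            image_eq_self_of_fix (k := Sum.elim id id ∘ Function.Embedding.inl)
              (fun x _ => rfl)] at h3
        rwa [this]
    · intro h
      by_cases he0 : e ⊆ E₀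
      · refine Or.inr ⟨e, h, ?_⟩
        rw [Finset.map_eq_image]
        exact Finset.image_congr fun x hx => hφl x (he0 hx)
      · exact Or.inl (Finset.mem_image_of_mem _ ((hmem𝒢 e).2 ⟨he, h, he0⟩))
  · rw [h0.finStrong_iff_rk]
    refine le_antisymm (h0.rk_le le_rfl) (hβ.le_rk h0 ?_ fun P hP Y hY hsub => ?_)
    · rw [himE]
      exact Finset.union_subset_union_left hE₀A
    · rw [himE] at hsub ⊢
      have hYR : Y = R := subset_antisymm hY fun b hb => hβ.mem_of_mem_union hP hY hb
        (hsub (Finset.mem_union_right _ (Finset.mem_image_of_mem β hb)))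
      have hEP : E₀ ⊆ P := fun x hx => hβ.mem_of_mem_union_left hY (hE₀A hx)
        (hsub (Finset.mem_union_left _ hx))
      rw [hβ.pd_eq _ hE₀A _ le_rfl, hYR, hall _ hEP, hall _ le_rfl]
      have := finStrong_iff.1 hE₀ P hEP
      linarith
  · rw [hAim]
    exact hβ.strong
  · rw [hAim, hβ.pd_eq A le_rfl R le_rfl, hall A hE₀A, hcard]
    ring

/-- Any finite set can be moved over `cl^d(Z)` to be independent from a given finite set. -/
theorem IsGeneric.exists_indep (hH : H.IsGeneric n m) (hr : r ≠ 0) (hm : 1 ≤ m)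
    (Z E A : Finset V) :
    ∃ k ∈ H.autFixing (H.dcl n m (Z : Set V)),
      H.rk n m (E.image k ∪ A ∪ Z) + H.rk n m Z = H.rk n m (E ∪ Z) + H.rk n m (A ∪ Z) := by
  classical
  have h0 : H.Nonneg n m := (inC0_iff hr).1 hH.inC0
  rcases isEmpty_or_nonempty V with hV | hV
  · refine ⟨1, one_mem _, ?_⟩
    rw [Finset.eq_empty_of_isEmpty Z, Finset.eq_empty_of_isEmpty E, Finset.eq_empty_of_isEmpty A]
    rfl
  obtain ⟨E', hEE', hE's, hE'r, -⟩ := h0.exists_cl0 (E ∪ Z)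
  obtain ⟨hEE, hZE⟩ := Finset.union_subset_iff.1 hEE'
  -- Amalgamating over the whole trace of `cl^d(Z)`, rather than over `Z`, makes the free copy fix
  -- every point of `E'` that must not move.
  set E₀ := E'.filter (· ∈ H.dcl n m (Z : Set V)) with hE₀
  have hE₀s := h0.finStrong_filter_dcl hE's hZE
  rw [← hE₀] at hE₀s
  have hZE₀ : Z ⊆ E₀ := fun x hx => Finset.mem_filter.2 ⟨hZE hx, h0.subset_dcl Z hx⟩
  have hE₀Z : (E₀ : Set V) ⊆ H.dcl n m (Z : Set V) := fun x hx => (Finset.mem_filter.1 hx).2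
  obtain ⟨A', hAA', hA's, hA'r, -⟩ := h0.exists_cl0 (A ∪ E₀)
  obtain ⟨hAA, hE₀A⟩ := Finset.union_subset_iff.1 hAA'
  obtain ⟨f, hf1, hf2, hf3, hf4, hf5⟩ := hH.exists_free_copy hr hA's hE₀s
    (Finset.filter_subset _ _) hE₀A
  have hpa : PartialAut H n m Z E' f := ⟨hZE, hE's, hf3, hf1, fun x hx hxZ =>
    hf2 x (Finset.mem_filter.2 ⟨hx, hxZ⟩)⟩
  obtain ⟨k, hk, hkf⟩ := hpa.exists_autFixing hH hr hm
  refine ⟨k, hk, ?_⟩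
  have hkZ : Z.image k = Z := image_eq_self_of_fix fun x hx => hk.2 x (h0.subset_dcl Z hx)
  have hkE' : E'.image k = E'.image f := Finset.image_congr hkf
  have e1 : H.rk n m (E.image k ∪ Z) = H.rk n m (E ∪ Z) := by
    conv_lhs => rw [← hkZ]
    rw [← Finset.image_union, h0.rk_image_aut hk.1]
  have e2 : H.rk n m (E'.image f) = H.rk n m (E ∪ Z) := by
    rw [← hkE', h0.rk_image_aut hk.1, ← hE'r, h0.finStrong_iff_rk.1 hE's]
  have e3 : H.rk n m E₀ = H.rk n m Z := by
    have := h0.subset_dcl_iff.1 hE₀Z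
    rwa [Finset.union_eq_right.2 hZE₀] at this
  have e4 : H.rk n m A' = H.rk n m (A ∪ Z) := by
    rw [h0.finStrong_iff_rk.1 hA's, hA'r]
    have := h0.rk_union_of_subset_dcl hE₀Z A
    rw [Finset.union_comm A Z, ← this]
    congr 1
    ext x
    simp only [Finset.mem_union]
    have := @hZE₀ x
    tauto
  rw [← h0.finStrong_iff_rk.1 hE₀s, ← h0.finStrong_iff_rk.1 hE's, ← h0.finStrong_iff_rk.1 hA's,
    ← h0.finStrong_iff_rk.1 hf4, e3, e4, h0.finStrong_iff_rk.1 hE's, hE'r] at hf5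
  have hsubE : E.image k ∪ Z ⊆ E'.image f := by
    rw [← hkE']
    refine Finset.union_subset (Finset.image_subset_image hEE) ?_
    rw [← hkZ]
    exact Finset.image_subset_image hZE
  -- `i1` is the upper bound. `i2` and `i3` transfer the lower bound from the closures `E'` and
  -- `A'`, which have the same rank as the sets they enlarge.
  have i1 := h0.rk_submod' (X := E.image k ∪ Z) (Y := A ∪ Z) (Z := Z) (U := E.image k ∪ A ∪ Z)
    (by intro x; simp only [Finset.mem_union]; tauto) Finset.subset_union_right
    Finset.subset_union_right
  have i2 := h0.rk_submod' (X := E.image k ∪ A ∪ Z) (Y := E'.image f) (Z := E.image k ∪ Z)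
    (U := E'.image f ∪ A ∪ Z) (by intro x; simp only [Finset.mem_union]; tauto)
    (by intro x; simp only [Finset.mem_union]; tauto) hsubE
  have i3 := h0.rk_submod' (X := E'.image f ∪ A ∪ Z) (Y := A') (Z := A ∪ Z)
    (U := A' ∪ E'.image f) (by intro x; simp only [Finset.mem_union]; tauto)
    (by intro x; simp only [Finset.mem_union]; tauto)
    (Finset.union_subset hAA (hZE₀.trans hE₀A))
  linarith

end Independence

/-! ### Independent families of conjugates. -/

section Copies

variable {r : ℕ} {V : Type*} {H : UHypergraph r V} {n m : ℕ} [DecidableEq V]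

lemma Nonneg.rk_diff_anti (h0 : H.Nonneg n m) (E : Finset V) {X Y : Finset V} (h : X ⊆ Y) :
    H.rk n m (E ∪ Y) + H.rk n m X ≤ H.rk n m (E ∪ X) + H.rk n m Y :=
  h0.rk_submod' (by intro x; simp only [Finset.mem_union]; tauto) Finset.subset_union_right h

lemma Nonneg.rk_diff_insert_anti (h0 : H.Nonneg n m) (a : V) {X Y : Finset V} (h : X ⊆ Y) :
    H.rk n m (insert a Y) + H.rk n m X ≤ H.rk n m (insert a X) + H.rk n m Y := by
  simpa only [Finset.singleton_union] using h0.rk_diff_anti {a} h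

/-- As `P` already contains `F i` and `Z`, adding `E i` costs at most its relative dimension over
these. -/
lemma Nonneg.rk_union_biUnion_le (h0 : H.Nonneg n m) {ι : Type*} {s : Finset ι}
    {Z P : Finset V} (hZP : Z ⊆ P) {E F : ι → Finset V} (hFE : ∀ i ∈ s, F i ⊆ E i)
    (hFP : ∀ i ∈ s, F i ⊆ P) :
    H.rk n m (P ∪ s.biUnion E)
      ≤ H.rk n m P + ∑ i ∈ s, (H.rk n m (E i ∪ Z) - H.rk n m (F i ∪ Z)) := by
  classical
  induction s using Finset.induction_on with
  | empty => simp
  | insert i s hi ih =>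
    have h1 := ih (fun j hj => hFE j (Finset.mem_insert_of_mem hj))
      (fun j hj => hFP j (Finset.mem_insert_of_mem hj))
    rw [Finset.sum_insert hi, Finset.biUnion_insert]
    have h2 := h0.rk_submod' (X := P ∪ s.biUnion E) (Y := E i ∪ Z)
      (Z := F i ∪ Z) (U := P ∪ (E i ∪ s.biUnion E))
      (by intro x; simp only [Finset.mem_union]; tauto)
      ((Finset.union_subset (hFP i (Finset.mem_insert_self i s)) hZP).trans
        Finset.subset_union_left)
      (Finset.union_subset_union_left (hFE i (Finset.mem_insert_self i s)))
    linarith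

/-- Subsets of the members of an independent family form an independent family. -/
lemma Nonneg.indep_subfamily (h0 : H.Nonneg n m) {ι : Type*} {s : Finset ι}
    {Z B : Finset V} (hZB : Z ⊆ B) {E F : ι → Finset V} (hFE : ∀ i ∈ s, F i ⊆ E i)
    (h : H.rk n m B + ∑ i ∈ s, (H.rk n m (E i ∪ Z) - H.rk n m Z) ≤ H.rk n m (B ∪ s.biUnion E)) :
    H.rk n m B + ∑ i ∈ s, (H.rk n m (F i ∪ Z) - H.rk n m Z) ≤ H.rk n m (B ∪ s.biUnion F) := by
  -- Passing back from the `F i` to the `E i` costs at most the difference of the two sums, so a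
  -- deficit for `F` would give one for `E`.
  have h1 := h0.rk_union_biUnion_le (P := B ∪ s.biUnion F) (s := s)
    (hZB.trans Finset.subset_union_left) hFE
    (fun i hi => (Finset.subset_biUnion_of_mem F hi).trans Finset.subset_union_right)
  have h2 := h0.rk_mono (X := B ∪ s.biUnion E) (Y := (B ∪ s.biUnion F) ∪ s.biUnion E)
    (by intro x; simp only [Finset.mem_union]; tauto)
  simp only [Finset.sum_sub_distrib] at h h1 ⊢
  linarith

lemma Nonneg.rk_image_union_of_fix (h0 : H.Nonneg n m) {k : Equiv.Perm V} {Z : Finset V}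
    (hk : k ∈ H.autFixing (H.dcl n m (Z : Set V))) (E : Finset V) :
    H.rk n m (E.image k ∪ Z) = H.rk n m (E ∪ Z) := by
  have hkZ : Z.image k = Z := image_eq_self_of_fix fun x hx => hk.2 x (h0.subset_dcl Z hx)
  conv_lhs => rw [← hkZ]
  rw [← Finset.image_union, h0.rk_image_aut hk.1]

/-- Independent copies of `E` over `Z`, independent moreover from `B ⊇ Z`. -/
theorem IsGeneric.exists_copies (hH : H.IsGeneric n m) (hr : r ≠ 0) (hm : 1 ≤ m)
    {Z B : Finset V} (hZB : Z ⊆ B) (E : Finset V) (N : ℕ) :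
    ∃ h : ℕ → Equiv.Perm V, (∀ i, h i ∈ H.autFixing (H.dcl n m (Z : Set V))) ∧
      ∀ F : ℕ → Finset V, (∀ i, F i ⊆ E) →
        H.rk n m B + ∑ i ∈ Finset.range N, (H.rk n m (F i ∪ Z) - H.rk n m Z)
          ≤ H.rk n m (B ∪ (Finset.range N).biUnion fun i => (F i).image (h i)) := by
  have h0 : H.Nonneg n m := (inC0_iff hr).1 hH.inC0
  suffices hs : ∃ h : ℕ → Equiv.Perm V, (∀ i, h i ∈ H.autFixing (H.dcl n m (Z : Set V))) ∧
      H.rk n m B + N * (H.rk n m (E ∪ Z) - H.rk n m Z)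
          ≤ H.rk n m (B ∪ (Finset.range N).biUnion fun i => E.image (h i)) by
    obtain ⟨h, h1, h2⟩ := hs
    refine ⟨h, h1, fun F hF => ?_⟩
    have h3 := h0.indep_subfamily (s := Finset.range N) (E := fun i => E.image (h i))
      (F := fun i => (F i).image (h i)) hZB (fun i _ => Finset.image_subset_image (hF i))
      (by simpa [h0.rk_image_union_of_fix (h1 _), mul_sub] using h2)
    simpa [h0.rk_image_union_of_fix (h1 _)] using h3
  induction N with
  | zero => exact ⟨fun _ => 1, fun _ => one_mem _, by simp⟩
  | succ N ih =>
    obtain ⟨h, h1, h2⟩ := ih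
    -- The next copy is chosen independent from `B` together with all earlier copies.
    obtain ⟨k, hk1, hk2⟩ := hH.exists_indep hr hm Z E
      (B ∪ (Finset.range N).biUnion fun i => E.image (h i))
    refine ⟨Function.update h N k, fun i => ?_, ?_⟩
    · by_cases hi : i = N
      · rw [hi, Function.update_self]
        exact hk1
      · rw [Function.update_of_ne hi]
        exact h1 i
    · have e1 : ((Finset.range N).biUnion fun i => E.image (Function.update h N k i))
          = (Finset.range N).biUnion fun i => E.image (h i) :=
        Finset.biUnion_congr rfl fun i hi => by
          rw [Function.update_of_ne (Finset.mem_range.1 hi).ne]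
      rw [Finset.range_add_one, Finset.biUnion_insert, e1, Function.update_self]
      set Q := (Finset.range N).biUnion fun i => E.image (h i)
      rw [show B ∪ Q ∪ Z = B ∪ Q by
        rw [Finset.union_eq_left]; exact hZB.trans Finset.subset_union_left,
        show E.image k ∪ (B ∪ Q) ∪ Z = B ∪ (E.image k ∪ Q) by
          ext x
          have := @hZB x
          simp only [Finset.mem_union]
          tauto] at hk2
      push_cast
      linarith

end Copies

/-! ### From boundedness to controlled points. -/

section Controlled

lemma autFixing_mono {r : ℕ} {V : Type*} {H : UHypergraph r V} {C D : Set V} (h : C ⊆ D) : H.autFixing D ≤ H.autFixing C :=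
  fun _ hk => ⟨hk.1, fun x hx => hk.2 x (h hx)⟩

variable {r : ℕ} {V : Type*} {H : UHypergraph r V} {n m : ℕ} [DecidableEq V]

/-- `g s' ∈ cl^d(Z s')` for all `s'` in the orbit of `s` over `cl^d(Z)`. -/
def Controlled (H : UHypergraph r V) (n m : ℕ) (g : Equiv.Perm V) (Z : Finset V) (s : V) : Prop :=
  ∀ k ∈ H.autFixing (H.dcl n m (Z : Set V)),
    g (k s) ∈ H.dcl n m ((insert (k s) Z : Finset V) : Set V)

lemma Controlled.apply {g k : Equiv.Perm V} {Z : Finset V} {s : V} (h : Controlled H n m g Z s)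
    (hk : k ∈ H.autFixing (H.dcl n m (Z : Set V))) : Controlled H n m g Z (k s) := fun k' hk' => by
  have := h (k' * k) (mul_mem hk' hk)
  simpa using this

lemma Nonneg.relDim_dcl_union (h0 : H.Nonneg n m) (a c : V) (X : Finset V) :
    H.relDim n m {a} (H.dcl n m (X : Set V) ∪ {c})
      = H.rk n m (insert a (insert c X)) - H.rk n m (insert c X) := by
  have := h0.relDim_eq (X := {a}) (W := insert c X) (Z := H.dcl n m (X : Set V) ∪ {c})
    (by
      rw [Finset.coe_insert, Set.insert_subset_iff]
      exact ⟨by simp, (h0.subset_dcl X).trans Set.subset_union_left⟩)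
    (fun Y hY => h0.subset_dcl_iff.1 (hY.trans (Set.union_subset
      (h0.dcl_mono_of_subset (Finset.subset_insert _ _))
      (by simpa using h0.subset_dcl (insert c X) (Finset.mem_insert_self c X)))))
  rwa [Finset.coe_singleton, Finset.singleton_union] at this

lemma Nonneg.relDim_singleton_dcl (h0 : H.Nonneg n m) (a : V) (X : Finset V) :
    H.relDim n m {a} (H.dcl n m (X : Set V)) = H.rk n m (insert a X) - H.rk n m X := by
  have := h0.relDim_dcl {a} X
  rwa [Finset.coe_singleton, Finset.singleton_union] at this

/-- For `b` basic over `cl^d(X)` witnessing that `g` is not unbounded, `b'` depends on `g b'`. -/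
lemma Nonneg.mem_dcl_of_not_indep (h0 : H.Nonneg n m) {g : Equiv.Perm V} {X : Finset V} {b b' : V}
    (hb : H.IsBasic n m b (H.dcl n m (X : Set V))) (hb' : b' ∈ H.orb (H.dcl n m (X : Set V)) b)
    (hind : ¬ H.Indep n m (g b') (H.dcl n m (X : Set V)) b') :
    b' ∈ H.dcl n m ((insert (g b') X : Finset V) : Set V) := by
  obtain ⟨k, hk, rfl⟩ := hb'
  set c := g (k b) with hc
  rw [Indep, h0.relDim_dcl_union, h0.relDim_singleton_dcl] at hind
  have hkX : X.image k = X := image_eq_self_of_fix fun x hx => hk.2 x (h0.subset_dcl X hx)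
  have h1 := h0.rk_diff_insert_anti c (Finset.subset_insert (k b) X)
  have e1 : (insert (k⁻¹ c) X).image k = insert c X := by
    rw [Finset.image_insert, hkX]; simp
  have e2 : (insert b (insert (k⁻¹ c) X)).image k = insert (k b) (insert c X) := by
    rw [Finset.image_insert, e1]
  have e3 : (insert b X).image k = insert (k b) X := by rw [Finset.image_insert, hkX]
  -- Basicness concerns `b` itself, so the dependence of `k b` on `c` is pulled back by `k`.
  -- Symmetry of the dimension drop turns dependence of `c` on `k b` into the drop for `b` that
  -- basicness needs.
  have h2 := hb.2 (H.dcl n m ((insert (k⁻¹ c) X : Finset V) : Set V))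
    ⟨_, Finset.finite_toSet _, rfl⟩ (h0.dcl_mono_of_subset (Finset.subset_insert _ _)) (by
      rw [h0.relDim_singleton_dcl, h0.relDim_singleton_dcl, ← h0.rk_image_aut hk.1, e2,
        ← h0.rk_image_aut hk.1 (insert (k⁻¹ c) X), e1, ← h0.rk_image_aut hk.1 (insert b X), e3,
        Finset.insert_comm]
      have : H.rk n m (insert c (insert (k b) X)) - H.rk n m (insert (k b) X)
          < H.rk n m (insert c X) - H.rk n m X := lt_of_le_of_ne (by linarith) hind
      linarith)
  rw [← h0.mem_dcl_image hk.1, e1] at h2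
  exact h2

/-- A bounded automorphism controls some point outside `cl^d(Z)`, for some finite `Z`. -/
theorem IsGeneric.exists_controlled (hH : H.IsGeneric n m) (hr : r ≠ 0) (hm : 1 ≤ m)
    {g : Equiv.Perm V} (hg : g ∈ H.aut) (hb : H.IsBounded n m g) :
    ∃ (Z : Finset V) (s : V), Controlled H n m g Z s ∧ s ∉ H.dcl n m (Z : Set V) := by
  have h0 : H.Nonneg n m := (inC0_iff hr).1 hH.inC0
  -- Only the failure of unboundedness over `cl^d(∅)` is needed.
  obtain ⟨C, ⟨X, hX, rfl⟩, -, b, hbas, hor⟩ : ∃ C ∈ H.closures n m, H.dcl n m ∅ ⊆ C ∧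
      ∃ b, H.IsBasic n m b C ∧ ∀ b' ∈ H.orb C b, ¬ H.Indep n m (g b') C b' := by
    by_contra hcon
    push Not at hcon
    exact hb ⟨_, ⟨∅, Set.finite_empty, rfl⟩, fun C hC hAC b hbC => by
      obtain ⟨b', h1, h2⟩ := hcon C hC hAC b hbC
      exact ⟨b', h1, h2⟩⟩
  lift X to Finset V using hX
  have hdep : ∀ b' ∈ H.orb (H.dcl n m (X : Set V)) b,
      b' ∈ H.dcl n m ((insert (g b') X : Finset V) : Set V) := fun b' hb' =>
    h0.mem_dcl_of_not_indep hbas hb' (hor b' hb')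
  -- These sets satisfy `g D' = D`, so `d(g s/D) = d(s/D')` can be compared with `d(s/D)`.
  set D := X ∪ X.image g with hD
  set D' := X ∪ X.image ⇑g⁻¹ with hD'
  have hD'D : D'.image g = D := by
    rw [hD', Finset.image_union, Finset.image_image, hD, Finset.union_comm]
    congr 1
    exact image_eq_self_of_fix fun x _ => by simp
  set Z := D ∪ D' with hZ
  have hXZ : X ⊆ Z := Finset.subset_union_left.trans Finset.subset_union_left
  obtain ⟨k, hk, hkr⟩ := hH.exists_indep hr hm X {b} Z
  rw [Finset.union_eq_left.2 hXZ, Finset.image_singleton, Finset.union_assoc,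
    Finset.union_eq_left.2 hXZ, Finset.singleton_union, Finset.singleton_union] at hkr
  refine ⟨Z, k b, fun h hh => ?_, fun hcon => ?_⟩
  · have hhX := autFixing_mono (h0.dcl_mono_of_subset hXZ) hh
    set s := h (k b) with hs
    have hsor : s ∈ H.orb (H.dcl n m (X : Set V)) b := ⟨h * k, mul_mem hhX hk, rfl⟩
    have r1 : H.rk n m (insert s Z) = H.rk n m (insert (k b) Z) := by
      have := h0.rk_image_union_of_fix hh {k b}
      simpa only [Finset.image_singleton, Finset.singleton_union] using this
    have r2 : H.rk n m (insert s X) = H.rk n m (insert b X) := by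
      have := h0.rk_image_union_of_fix (mul_mem hhX hk) {b}
      simp only [Finset.image_singleton, Finset.singleton_union] at this
      exact this
    -- Relative dimension decreases from `X` to `Z`, and `s` was chosen with equal values at the two
    -- ends.
    have sand : ∀ Y, X ⊆ Y → Y ⊆ Z → H.rk n m (insert s Y) - H.rk n m Y
        = H.rk n m (insert b X) - H.rk n m X := fun Y h1 h2 => by
      have h3 := h0.rk_diff_insert_anti s h1
      have h4 := h0.rk_diff_insert_anti s h2
      linarith
    have s1 := sand D Finset.subset_union_left Finset.subset_union_left
    have s2 := sand D' Finset.subset_union_left Finset.subset_union_right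
    rw [← h0.rk_image_aut hg, ← h0.rk_image_aut hg D', Finset.image_insert, hD'D] at s2
    have s3 := h0.mem_dcl.1 (h0.dcl_mono_of_subset
      (Finset.insert_subset_insert (g s) (Finset.subset_union_left : X ⊆ D)) (hdep s hsor))
    refine h0.dcl_mono_of_subset (Finset.insert_subset_insert s
      (Finset.subset_union_left : D ⊆ Z)) ?_
    -- Over `D`, both `s` and `g s` have the same dimension, and adding `s` to `g s` costs nothing;
    -- hence neither does adding `g s` to `s`.
    rw [h0.mem_dcl, Finset.insert_comm, s3]
    linarith
  · have h1 := h0.mem_dcl.1 hcon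
    refine hbas.1 (h0.mem_dcl.2 ?_)
    linarith

end Controlled

/-! ### The incidence pattern of the chain: two partitions of an interval of `n * m` cells. -/

section Blocks

/-- Cut an interval of `n * m` cells into `n` blocks of length `m` and into `m` blocks of length
`n`: the set of blocks of the second kind that meet the `i`-th block of the first kind. -/
def meetingBlocks (n m i : ℕ) : Finset ℕ :=
  (Finset.range m).filter fun j => i * m < (j + 1) * n ∧ j * n < (i + 1) * m

variable {n m : ℕ}

lemma mem_meetingBlocks {i j : ℕ} :
    j ∈ meetingBlocks n m i ↔ j < m ∧ i * m < (j + 1) * n ∧ j * n < (i + 1) * m := by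
  simp [meetingBlocks]

/-- Cell `i * m + c` lies both in block `i` of the first kind and in the block of the second kind
given by the quotient. -/
lemma div_mem_meetingBlocks {i c : ℕ} (hi : i < n) (hc : c < m) :
    (i * m + c) / n ∈ meetingBlocks n m i := by
  have hn : 0 < n := by omega
  have h1 := Nat.div_mul_le_self (i * m + c) n
  have h2 : i * m + c < ((i * m + c) / n + 1) * n := by
    have := Nat.div_add_mod' (i * m + c) n
    have := Nat.mod_lt (i * m + c) hn
    linarith
  have h3 : (i + 1) * m ≤ n * m := Nat.mul_le_mul_right m hi
  rw [mem_meetingBlocks]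
  refine ⟨?_, ?_, ?_⟩
  · rw [Nat.div_lt_iff_lt_mul hn]
    nlinarith
  · nlinarith
  · nlinarith

lemma card_meetingBlocks_pos (hm : 1 ≤ m) {i : ℕ} (hi : i < n) :
    0 < (meetingBlocks n m i).card :=
  Finset.card_pos.2 ⟨_, div_mem_meetingBlocks hi hm⟩

/-- A block of length `m ≤ n` crosses at most one boundary between blocks of length `n`. -/
lemma meetingBlocks_subset (hmn : m ≤ n) (hm : 1 ≤ m) (i : ℕ) :
    meetingBlocks n m i ⊆ {i * m / n, i * m / n + 1} := by
  intro j hj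
  have hn : 0 < n := by omega
  obtain ⟨-, h1, h2⟩ := mem_meetingBlocks.1 hj
  have h3 : i * m / n < j + 1 := (Nat.div_lt_iff_lt_mul hn).2 h1
  have h4 : i * m < (i * m / n + 1) * n := by
    have := Nat.div_add_mod (i * m) n
    have := Nat.mod_lt (i * m) hn
    nlinarith
  have h5 : j < i * m / n + 2 := by
    by_contra hcon
    have : (i * m / n + 2) * n ≤ j * n := Nat.mul_le_mul_right n (not_lt.1 hcon)
    nlinarith
  simp only [Finset.mem_insert, Finset.mem_singleton]
  omega

lemma card_meetingBlocks_le (hmn : m ≤ n) (hm : 1 ≤ m) (i : ℕ) :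
    (meetingBlocks n m i).card ≤ 2 :=
  (Finset.card_le_card (meetingBlocks_subset hmn hm i)).trans Finset.card_le_two

lemma meetingBlocks_zero (hmn : m ≤ n) (hm : 1 ≤ m) : meetingBlocks n m 0 = {0} := by
  ext j
  rw [mem_meetingBlocks, Finset.mem_singleton]
  constructor
  · rintro ⟨-, -, h⟩
    by_contra hj
    have : 1 * n ≤ j * n := Nat.mul_le_mul_right n (by omega)
    omega
  · rintro rfl
    refine ⟨by omega, by omega, by omega⟩

lemma card_meetingBlocks_last (hmn : m ≤ n) (hm : 1 ≤ m) :
    (meetingBlocks n m (n - 1)).card ≤ 1 := by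
  have : meetingBlocks n m (n - 1) ⊆ {m - 1} := by
    intro j hj
    obtain ⟨h1, h2, -⟩ := mem_meetingBlocks.1 hj
    rw [Finset.mem_singleton]
    by_contra hcon
    obtain ⟨a, rfl⟩ : ∃ a, m = j + 2 + a := ⟨m - (j + 2), by omega⟩
    obtain ⟨b, rfl⟩ : ∃ b, n = b + 1 := ⟨n - 1, by omega⟩
    rw [Nat.add_sub_cancel] at h2
    nlinarith
  exact (Finset.card_le_card this).trans (Finset.card_singleton _).le

/-- A boundary point is interior to at most one block of the first kind. This keeps hyperedges
distinct when `r = 2` and both endpoints are new. -/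
lemma eq_of_meetingBlocks_eq (hmn : m ≤ n) (hm : 1 ≤ m) {i i' : ℕ}
    (h : meetingBlocks n m i = meetingBlocks n m i') (h2 : (meetingBlocks n m i).card = 2) :
    i = i' := by
  have hsub := meetingBlocks_subset hmn hm i
  have heq := Finset.eq_of_subset_of_card_le hsub (by rw [h2]; exact Finset.card_le_two)
  set j := i * m / n
  have a1 : j ∈ meetingBlocks n m i := by rw [heq]; simp
  have a2 : j + 1 ∈ meetingBlocks n m i := by rw [heq]; simp
  have b1 := a1
  have b2 := a2
  rw [h] at b1 b2
  obtain ⟨-, c1, -⟩ := mem_meetingBlocks.1 a1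
  obtain ⟨-, -, c2⟩ := mem_meetingBlocks.1 a2
  obtain ⟨-, d1, -⟩ := mem_meetingBlocks.1 b1
  obtain ⟨-, -, d2⟩ := mem_meetingBlocks.1 b2
  have e1 := Nat.lt_of_mul_lt_mul_right (c1.trans d2)
  have e2 := Nat.lt_of_mul_lt_mul_right (d1.trans c2)
  omega

/-- Counting cells: blocks of the first kind covered by blocks of the second kind. -/
lemma mul_card_le_of_meetingBlocks {F Y : Finset ℕ} (hF : F ⊆ Finset.range n)
    (h : ∀ i ∈ F, meetingBlocks n m i ⊆ Y) : m * F.card ≤ n * Y.card := by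
  have hcard := Finset.card_le_card_of_injOn (s := F ×ˢ Finset.range m) (t := Y ×ˢ Finset.range n)
    (fun p => ((p.1 * m + p.2) / n, (p.1 * m + p.2) % n))
    (by
      rintro ⟨i, c⟩ hp
      simp only [Finset.coe_product, Set.mem_prod, Finset.mem_coe, Finset.mem_range] at hp ⊢
      have hi := Finset.mem_range.1 (hF hp.1)
      exact ⟨h i hp.1 (div_mem_meetingBlocks hi hp.2), Nat.mod_lt _ (by omega)⟩)
    (by
      rintro ⟨i, c⟩ hp ⟨i', c'⟩ hp' heq
      simp only [Finset.coe_product, Set.mem_prod, Finset.mem_coe, Finset.mem_range] at hp hp'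
      simp only [Prod.mk.injEq] at heq
      have h1 : i * m + c = i' * m + c' := by
        rw [← Nat.div_add_mod (i * m + c) n, ← Nat.div_add_mod (i' * m + c') n, heq.1, heq.2]
      have h2 : i = i' := by
        have e1 : i < i' + 1 := by
          by_contra hcon
          have := Nat.mul_le_mul_right m (not_lt.1 hcon)
          nlinarith
        have e2 : i' < i + 1 := by
          by_contra hcon
          have := Nat.mul_le_mul_right m (not_lt.1 hcon)
          nlinarith
        omega
      subst h2
      simpa using h1)
  rw [Finset.card_product, Finset.card_product, Finset.card_range, Finset.card_range] at hcard
  rwa [mul_comm m, mul_comm n]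

end Blocks

/-! ### Reached points of increasing dimension. -/

section Climb

variable {r : ℕ} {V : Type*} {H : UHypergraph r V} {n m : ℕ} [DecidableEq V]

/-- `y ∈ cl^d(Z ∪ S)` for some finite set `S` of controlled points. -/
def Reached (H : UHypergraph r V) (n m : ℕ) (g : Equiv.Perm V) (Z : Finset V) (y : V) : Prop :=
  ∃ S : Finset V, (∀ s ∈ S, Controlled H n m g Z s) ∧ y ∈ H.dcl n m ((Z ∪ S : Finset V) : Set V)

lemma Nonneg.image_mem_dcl_of_fix (h0 : H.Nonneg n m) {k : Equiv.Perm V} {Z S : Finset V} {y : V}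
    (hk : k ∈ H.autFixing (H.dcl n m (Z : Set V)))
    (hy : y ∈ H.dcl n m ((Z ∪ S : Finset V) : Set V)) :
    k y ∈ H.dcl n m ((Z ∪ S.image k : Finset V) : Set V) := by
  have hkZ : Z.image k = Z := image_eq_self_of_fix fun x hx => hk.2 x (h0.subset_dcl Z hx)
  rwa [← h0.mem_dcl_image hk.1, Finset.image_union, hkZ] at hy

/-- The dimension over `Z` of a reached point can be increased, by adjoining `m` points and `n`
hyperedges to independent copies. -/
lemma IsGeneric.climb_step (hH : H.IsGeneric n m) (hm : 1 ≤ m) (hmn : m ≤ n) (hn : 2 ≤ n)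
    (hr : 2 ≤ r) (hco : Nat.Coprime n m) {g : Equiv.Perm V} {Z : Finset V} {y : V}
    (hy : Reached H n m g Z y) (hpos : 1 ≤ H.rk n m (insert y Z) - H.rk n m Z)
    (hle : H.rk n m (insert y Z) - H.rk n m Z ≤ m) :
    ∃ y', Reached H n m g Z y' ∧
      H.rk n m (insert y Z) + 1 ≤ H.rk n m (insert y' Z) := by
  have hr0 : r ≠ 0 := by omega
  have : Nonempty V := ⟨y⟩
  have h0 : H.Nonneg n m := (inC0_iff hr0).1 hH.inC0
  obtain ⟨S, hS, hyS⟩ := hy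
  set κ := H.rk n m (insert y Z) - H.rk n m Z with hκ
  -- There are `r` copies reserved for each of the `n` hyperedges: hyperedge `i` takes its old
  -- vertices, the leaves, among the copies numbered `i * r + t` with `t < r`.
  obtain ⟨h, hfix, hind⟩ := hH.exists_copies hr0 hm (le_refl Z) (insert y S) (n * r)
  set ℓ : ℕ → V := fun j => h j y with hℓ
  have hlower : ∀ J ⊆ Finset.range (n * r), ∀ P : Finset V, Z ⊆ P → (∀ j ∈ J, ℓ j ∈ P) →
      H.rk n m Z + J.card * κ ≤ H.pd n m P := by
    intro J hJ P hZP hP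
    have h1 := hind (fun i => if i ∈ J then {y} else ∅) (fun i => by
      by_cases hi : i ∈ J <;> simp [hi])
    have h2 : ∑ i ∈ Finset.range (n * r),
        (H.rk n m ((if i ∈ J then {y} else ∅) ∪ Z) - H.rk n m Z) = J.card * κ := by
      have : ∀ i ∈ Finset.range (n * r),
          (H.rk n m ((if i ∈ J then {y} else ∅) ∪ Z) - H.rk n m Z) = if i ∈ J then κ else 0 := by
        intro i _
        by_cases hi : i ∈ J <;> simp [hi, hκ]
      rw [Finset.sum_congr rfl this, ← Finset.sum_filter, Finset.sum_const,
        Finset.filter_mem_eq_inter, Finset.inter_eq_right.2 hJ, nsmul_eq_mul]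
    rw [h2] at h1
    refine h1.trans (h0.rk_le (Finset.union_subset hZP ?_))
    intro x hx
    obtain ⟨i, -, hi⟩ := Finset.mem_biUnion.1 hx
    by_cases hiJ : i ∈ J
    · simp only [hiJ, if_true, Finset.image_singleton, Finset.mem_singleton] at hi
      rw [hi]
      exact hP i hiJ
    · simp [hiJ] at hi
  have hℓinj : ∀ i < n * r, ∀ j < n * r, ℓ i = ℓ j → i = j := by
    intro i hi j hj hij
    by_contra hne
    obtain ⟨T, hT, -, hTr, -⟩ := h0.exists_cl0 (insert (ℓ i) Z)
    rw [Finset.insert_subset_iff] at hT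
    have h1 := hlower {i, j} (by
      intro x; simp only [Finset.mem_insert, Finset.mem_singleton, Finset.mem_range]; omega) T hT.2
      (by
        intro x; simp only [Finset.mem_insert, Finset.mem_singleton]
        rintro (rfl | rfl)
        · exact hT.1
        · rw [← hij]; exact hT.1)
    rw [Finset.card_pair hne, hTr] at h1
    have h2 := h0.rk_image_union_of_fix (hfix i) {y}
    rw [Finset.image_singleton, Finset.singleton_union, Finset.singleton_union] at h2
    simp only [hℓ] at h1
    push_cast at h1
    linarith
  obtain ⟨D, hD, hDs, hDr, -⟩ := h0.exists_cl0
    (Z ∪ (Finset.range (n * r)).biUnion fun i => (insert y S).image (h i))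
  obtain ⟨hZD, hED⟩ := Finset.union_subset_iff.1 hD
  have hidx : ∀ i < n, ∀ t < r, i * r + t < n * r := fun i hi t ht => by
    have := Nat.mul_le_mul_right r (Nat.succ_le_of_lt hi)
    nlinarith
  let Y : ℕ → Finset ℕ := meetingBlocks n m
  let L : ℕ → Finset V := fun i => (Finset.range (r - (Y i).card)).image fun t => ℓ (i * r + t)
  let ε : ℕ → Finset (V ⊕ ℕ) := fun i => (L i).disjSum (Y i)
  have hYpos : ∀ i < n, 0 < (Y i).card := fun i hi => card_meetingBlocks_pos hm hi
  have hY2 : ∀ i, (Y i).card ≤ 2 := card_meetingBlocks_le hmn hm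
  have hεcard : ∀ i < n, (ε i).card = r := by
    intro i hi
    have h1 := hYpos i hi
    have h2 := hY2 i
    rw [Finset.card_disjSum, Finset.card_image_of_injOn, Finset.card_range]
    · omega
    · intro t ht t' ht' htt
      simp only [Finset.coe_range, Set.mem_Iio] at ht ht'
      have := hℓinj _ (hidx i hi t (by omega)) _ (hidx i hi t' (by omega)) htt
      omega
  have hLD : ∀ i < n, L i ⊆ D := by
    intro i hi x hx
    obtain ⟨t, ht, rfl⟩ := Finset.mem_image.1 hx
    rw [Finset.mem_range] at ht
    refine hED (Finset.mem_biUnion.2 ⟨i * r + t, Finset.mem_range.2 (hidx i hi t (by omega)), ?_⟩)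
    exact Finset.mem_image_of_mem _ (Finset.mem_insert_self _ _)
  have hεinj : Set.InjOn ε (Finset.range n : Finset ℕ) := by
    intro i hi i' hi' hii
    rw [Finset.mem_coe, Finset.mem_range] at hi hi'
    have hYY : Y i = Y i' := by
      have := congrArg Finset.toRight hii
      simpa [ε] using this
    have hLL : L i = L i' := by
      have := congrArg Finset.toLeft hii
      simpa [ε] using this
    have h1 := hYpos i hi
    have h2 := hY2 i
    -- A hyperedge having a leaf is identified by it; without leaves it has exactly two new vertices
    -- and these identify it.
    by_cases hlt : (Y i).card < r
    · have h3 : ℓ (i * r + 0) ∈ L i := Finset.mem_image.2 ⟨0, by simpa using hlt, rfl⟩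
      rw [hLL] at h3
      obtain ⟨t, ht, hte⟩ := Finset.mem_image.1 h3
      rw [Finset.mem_range] at ht
      have h4 := hYpos i' hi'
      have h5 := hℓinj _ (hidx i' hi' t (by omega)) _ (hidx i hi 0 (by omega)) hte
      have h6 : t < r := by omega
      have e1 : i < i' + 1 := by
        by_contra hcon
        have := Nat.mul_le_mul_right r (not_lt.1 hcon)
        nlinarith
      have e2 : i' < i + 1 := by
        by_contra hcon
        have := Nat.mul_le_mul_right r (not_lt.1 hcon)
        nlinarith
      omega
    · exact eq_of_meetingBlocks_eq hmn hm hYY (show (Y i).card = 2 by omega)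
  set 𝓕 := (Finset.range n).image ε with h𝓕
  have hεmem : ∀ i < n, ε i ∈ 𝓕 := fun i hi =>
    Finset.mem_image_of_mem _ (Finset.mem_range.2 hi)
  have h𝓕card : 𝓕.card = n := by rw [h𝓕, Finset.card_image_of_injOn hεinj, Finset.card_range]
  have hεsub : ∀ i < n, ε i ⊆ D.disjSum (Finset.range m) := fun i hi =>
    Finset.disjSum_mono (hLD i hi) (Finset.filter_subset _ _)
  obtain ⟨β, hβ⟩ := hH.adjoin hr0 hDs (Finset.range m) 𝓕
    (by
      intro e he
      obtain ⟨i, hi, rfl⟩ := Finset.mem_image.1 he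
      exact hεcard i (Finset.mem_range.1 hi))
    (by
      intro e he
      obtain ⟨i, hi, rfl⟩ := Finset.mem_image.1 he
      obtain ⟨b, hb⟩ := Finset.card_pos.1 (hYpos i (Finset.mem_range.1 hi))
      exact ⟨b, Finset.inr_mem_disjSum.2 hb⟩)
    (by
      intro T _
      have h1 : 𝓕.filter (fun e => e.toRight ⊆ T)
          ⊆ ((Finset.range n).filter (fun i => Y i ⊆ T)).image ε := by
        intro e he
        obtain ⟨he1, he2⟩ := Finset.mem_filter.1 he
        obtain ⟨i, hi, rfl⟩ := Finset.mem_image.1 he1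
        refine Finset.mem_image_of_mem _ (Finset.mem_filter.2 ⟨hi, ?_⟩)
        simpa [ε] using he2
      have h2 := (Finset.card_le_card h1).trans Finset.card_image_le
      have h3 := mul_card_le_of_meetingBlocks (n := n) (m := m) (Y := T)
        (Finset.filter_subset (fun i => Y i ⊆ T) (Finset.range n))
        (fun i hi => (Finset.mem_filter.1 hi).2)
      exact_mod_cast (Nat.mul_le_mul_left m h2).trans h3)
  have h0R : 0 ∈ Finset.range m := Finset.mem_range.2 (by omega)
  refine ⟨β 0, ⟨(Finset.range (n * r)).biUnion fun i => S.image (h i), ?_, ?_⟩, ?_⟩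
  · intro s hs
    obtain ⟨i, -, hi⟩ := Finset.mem_biUnion.1 hs
    obtain ⟨s', hs', rfl⟩ := Finset.mem_image.1 hi
    exact (hS s' hs').apply (hfix i)
  · set S' := (Finset.range (n * r)).biUnion fun i => S.image (h i) with hS'
    have hSS : ∀ i ∈ Finset.range (n * r), S.image (h i) ⊆ S' := fun i hi =>
      Finset.subset_biUnion_of_mem (fun i => S.image (h i)) hi
    have h1 : ((Z ∪ (Finset.range (n * r)).biUnion fun i => (insert y S).image (h i) : Finset V) :
        Set V) ⊆ H.dcl n m ((Z ∪ S' : Finset V) : Set V) := by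
      rw [Finset.coe_union, Set.union_subset_iff]
      refine ⟨fun x hx => h0.subset_dcl _ (Finset.mem_union_left _ hx), fun x hx => ?_⟩
      obtain ⟨i, hi, hx⟩ := Finset.mem_biUnion.1 hx
      obtain ⟨z, hz, rfl⟩ := Finset.mem_image.1 hx
      rcases Finset.mem_insert.1 hz with rfl | hz
      · exact h0.dcl_mono_of_subset (Finset.union_subset_union_right (hSS i hi))
          (h0.image_mem_dcl_of_fix (hfix i) hyS)
      · exact h0.subset_dcl _ (Finset.mem_union_right _ (hSS i hi (Finset.mem_image_of_mem _ hz)))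
    have h2 : (D : Set V) ⊆ H.dcl n m
        ((Z ∪ (Finset.range (n * r)).biUnion fun i => (insert y S).image (h i) : Finset V) :
        Set V) := by
      rw [h0.subset_dcl_iff, Finset.union_eq_right.2 hD, ← hDr]
      exact h0.finStrong_iff_rk.1 hDs
    -- The `m` points and `n` hyperedges contribute `nm - mn = 0` to the predimension.
    have h3 : ((D ∪ (Finset.range m).image β : Finset V) : Set V) ⊆ H.dcl n m (D : Set V) := by
      rw [h0.subset_dcl_iff, Finset.union_eq_right.2 Finset.subset_union_left]
      refine le_antisymm ?_ (h0.rk_mono Finset.subset_union_left)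
      refine (h0.rk_le le_rfl).trans ?_
      rw [hβ.pd_eq D le_rfl _ le_rfl, Finset.filter_true_of_mem, h𝓕card, Finset.card_range,
        h0.finStrong_iff_rk.1 hDs]
      · linarith [mul_comm (n : ℤ) m]
      · intro e he
        obtain ⟨i, hi, rfl⟩ := Finset.mem_image.1 he
        exact hεsub i (Finset.mem_range.1 hi)
    exact h0.dcl_mono h1 (h0.dcl_mono h2
      (h3 (Finset.mem_union_right _ (Finset.mem_image_of_mem β h0R))))
  · refine hβ.le_rk h0 ?_ fun P hP T hT hsub => ?_
    · refine Finset.insert_subset (Finset.mem_union_right _ (Finset.mem_image_of_mem β h0R))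
        (hZD.trans Finset.subset_union_left)
    have h0T : 0 ∈ T := hβ.mem_of_mem_union hP hT h0R (hsub (Finset.mem_insert_self _ _))
    have hZP : Z ⊆ P := fun x hx => hβ.mem_of_mem_union_left hT (hZD hx)
      (hsub (Finset.mem_insert_of_mem hx))
    set F := (Finset.range n).filter (fun i => ε i ⊆ P.disjSum T) with hF
    have hFn : F ⊆ Finset.range n := Finset.filter_subset _ _
    have hcard : ((𝓕.filter (· ⊆ P.disjSum T)).card : ℤ) ≤ F.card := by
      have h1 : 𝓕.filter (· ⊆ P.disjSum T) ⊆ F.image ε := by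
        intro e he
        obtain ⟨he1, he2⟩ := Finset.mem_filter.1 he
        obtain ⟨i, hi, rfl⟩ := Finset.mem_image.1 he1
        exact Finset.mem_image_of_mem _ (Finset.mem_filter.2 ⟨hi, he2⟩)
      exact_mod_cast (Finset.card_le_card h1).trans Finset.card_image_le
    have hcard' := mul_le_mul_of_nonneg_left hcard (Int.natCast_nonneg m)
    have hFT : ∀ i ∈ F, Y i ⊆ T := fun i hi j hj => by
      simpa using (Finset.mem_filter.1 hi).2 (Finset.inr_mem_disjSum.2 hj : Sum.inr j ∈ ε i)
    have hFle : F.card ≤ n := by simpa using Finset.card_le_card hFn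
    have hleaf : ∀ i ∈ F, (Y i).card ≤ 1 → ℓ (i * r) ∈ P := fun i hi hi1 => by
      have : Sum.inl (ℓ (i * r + 0)) ∈ ε i := Finset.inl_mem_disjSum.2
        (Finset.mem_image.2 ⟨0, Finset.mem_range.2 (by omega), rfl⟩)
      simpa using (Finset.mem_filter.1 hi).2 this
    have hY0 : Y 0 = {0} := meetingBlocks_zero hmn hm
    have hYl : (Y (n - 1)).card ≤ 1 := card_meetingBlocks_last hmn hm
    have hlast : n - 1 < n := by omega
    have hlast' : (n - 1) * r ∈ Finset.range (n * r) :=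
      Finset.mem_range.2 (hidx (n - 1) hlast 0 (by omega))
    have hzero' : 0 * r ∈ Finset.range (n * r) :=
      Finset.mem_range.2 (hidx 0 (by omega) 0 (by omega))
    have hP0 := hlower ∅ (Finset.empty_subset _) P hZP (by simp)
    rw [Finset.card_empty] at hP0
    push_cast at hP0
    have hcount : m * F.card ≤ n * T.card := mul_card_le_of_meetingBlocks hFn hFT
    -- Here `F` is the set of hyperedges present and `T` the set of new points present, with `0 ∈
    -- T`. A present end hyperedge brings in a leaf and hence dimension `κ`; a further `1` is
    -- wanted.
    by_cases hF0 : 0 ∈ F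
    · have hl0 := hleaf 0 hF0 (by rw [hY0, Finset.card_singleton])
      have hP1 := hlower {0 * r} (by simpa using hzero') P hZP (by simpa using hl0)
      rw [Finset.card_singleton] at hP1
      push_cast at hP1
      rcases hcount.lt_or_eq with hlt | heq
      · zify at hlt
        linarith
      -- Without slack, coprimality forces every hyperedge to be present, so the leaf at the other
      -- end gives a second `κ ≥ 1`.
      · have hdvd : n ∣ F.card := hco.dvd_of_dvd_mul_left (Dvd.intro _ heq.symm)
        have hFcard : F.card = n := le_antisymm hFle
          (Nat.le_of_dvd (Finset.card_pos.2 ⟨0, hF0⟩) hdvd)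
        have hFall : F = Finset.range n := Finset.eq_of_subset_of_card_le hFn (by simp [hFcard])
        have hl1 := hleaf (n - 1) (by rw [hFall]; exact Finset.mem_range.2 hlast) hYl
        have hne : 0 * r ≠ (n - 1) * r := by
          rw [Nat.zero_mul]
          exact (Nat.mul_pos (by omega) (by omega)).ne
        have hP2 := hlower {0 * r, (n - 1) * r}
          (Finset.insert_subset hzero' (Finset.singleton_subset_iff.2 hlast')) P hZP (by
            intro j hj
            rcases Finset.mem_insert.1 hj with rfl | hj
            · exact hl0
            · rw [Finset.mem_singleton.1 hj]
              exact hl1)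
        rw [Finset.card_pair hne] at hP2
        push_cast at hP2
        zify at heq
        linarith
    -- The missing hyperedge `0` could be added without new points, as its only new vertex is
    -- already in `T`. This leaves slack `m ≥ κ`; one more unit comes from the last leaf or from
    -- strictness.
    · have hcount' : m * (insert 0 F).card ≤ n * T.card := by
        refine mul_card_le_of_meetingBlocks
          (Finset.insert_subset (Finset.mem_range.2 (by omega)) hFn) fun i hi => ?_
        rcases Finset.mem_insert.1 hi with rfl | hi
        · change Y 0 ⊆ T
          rw [hY0, Finset.singleton_subset_iff]
          exact h0T
        · exact hFT i hi
      rw [Finset.card_insert_of_notMem hF0] at hcount'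
      by_cases hFl : n - 1 ∈ F
      · have hl1 := hleaf (n - 1) hFl hYl
        have hP1 := hlower {(n - 1) * r} (by simpa using hlast') P hZP (by simpa using hl1)
        rw [Finset.card_singleton] at hP1
        zify at hcount' hm
        push_cast at hP1
        linarith
      · rcases hcount'.lt_or_eq with hlt | heq
        · zify at hlt
          linarith
        -- Equality is impossible here: `F` omits two hyperedges, so `F.card + 1` lies strictly
        -- between `0` and `n`.
        · have hdvd : n ∣ F.card + 1 := hco.dvd_of_dvd_mul_left (Dvd.intro _ heq.symm)
          have h1 := Nat.le_of_dvd (Nat.succ_pos _) hdvd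
          have h2 := Finset.card_le_card
            (Finset.insert_subset (Finset.mem_range.2 (by omega : 0 < n))
              (Finset.insert_subset (Finset.mem_range.2 hlast) hFn))
          rw [Finset.card_insert_of_notMem, Finset.card_insert_of_notMem hFl,
            Finset.card_range] at h2
          · omega
          · rw [Finset.mem_insert]
            rintro (h3 | h3)
            · omega
            · exact hF0 h3

/-- There are reached points of large enough dimension over `Z`. -/
theorem IsGeneric.exists_reached (hH : H.IsGeneric n m) (hm : 1 ≤ m)
    (hpar : (r = 2 ∧ m < n) ∨ (3 ≤ r ∧ m ≤ n)) (hco : Nat.Coprime n m)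
    {g : Equiv.Perm V} {Z : Finset V} {s : V} (hs : Controlled H n m g Z s)
    (hsZ : s ∉ H.dcl n m (Z : Set V)) :
    ∃ y, Reached H n m g Z y ∧ 1 ≤ H.rk n m (insert y Z) - H.rk n m Z ∧
      (m : ℤ) < ((r : ℤ) - 1) * (H.rk n m (insert y Z) - H.rk n m Z) := by
  have hr : 2 ≤ r := by omega
  have hmn : m ≤ n := by omega
  have h0 : H.Nonneg n m := (inC0_iff (by omega)).1 hH.inC0
  have hr1 : (1 : ℤ) ≤ (r : ℤ) - 1 := by
    have : (2 : ℤ) ≤ r := by exact_mod_cast hr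
    linarith
  have key : ∀ k : ℕ, ∃ y, Reached H n m g Z y ∧ 1 ≤ H.rk n m (insert y Z) - H.rk n m Z ∧
      ((k : ℤ) ≤ H.rk n m (insert y Z) - H.rk n m Z ∨
        (m : ℤ) < ((r : ℤ) - 1) * (H.rk n m (insert y Z) - H.rk n m Z)) := by
    intro k
    induction k with
    | zero =>
      have h1 : H.rk n m Z < H.rk n m (insert s Z) :=
        lt_of_le_of_ne (h0.rk_mono (Finset.subset_insert _ _)) fun h => hsZ (h0.mem_dcl.2 h.symm)
      refine ⟨s, ⟨{s}, by simpa using hs, ?_⟩, by linarith, Or.inl ?_⟩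
      · exact h0.subset_dcl _ (Finset.mem_union_right _ (Finset.mem_singleton_self s))
      · push_cast
        linarith
    | succ k ih =>
      obtain ⟨y, hy, h1, h2⟩ := ih
      by_cases h3 : (m : ℤ) < ((r : ℤ) - 1) * (H.rk n m (insert y Z) - H.rk n m Z)
      · exact ⟨y, hy, h1, Or.inr h3⟩
      have h4 := h2.resolve_right h3
      -- If `n = 1` then `m = 1` and `r ≥ 3`, so the target inequality already holds.
      have hn2 : 2 ≤ n := by
        by_contra hn
        have hm1 : m = 1 := by omega
        have hr3 : 3 ≤ r := by omega
        have : (3 : ℤ) ≤ r := by exact_mod_cast hr3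
        subst hm1
        apply h3
        push_cast
        nlinarith
      obtain ⟨y', hy', h5⟩ := hH.climb_step hm hmn hn2 hr hco hy h1 (by nlinarith)
      exact ⟨y', hy', by linarith, Or.inl (by push_cast; linarith)⟩
  obtain ⟨y, hy, h1, h2⟩ := key (m + 1)
  refine ⟨y, hy, h1, h2.elim (fun h3 => ?_) id⟩
  push_cast at h3
  nlinarith

end Climb

/-! ### Points of maximal dimension, and the count of crossing hyperedges. -/

section GenericPoints

variable {r : ℕ} {V : Type*} {H : UHypergraph r V} {n m : ℕ} [DecidableEq V]

/-- `x` is a generic point over `W`. -/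
def GenericPoint (H : UHypergraph r V) (n m : ℕ) (W : Finset V) (x : V) : Prop :=
  H.rk n m (insert x W) = H.rk n m W + n

lemma Nonneg.rk_insert_le (h0 : H.Nonneg n m) (x : V) (W : Finset V) :
    H.rk n m (insert x W) ≤ H.rk n m W + n := by
  have h1 := h0.rk_diff_insert_anti x (Finset.empty_subset W)
  have h2 := h0.rk_le (le_refl (insert x (∅ : Finset V)))
  have h3 : H.pd n m (insert x ∅) ≤ n := by
    have : (0 : ℤ) ≤ m * ((H.edgesIn (insert x ∅)).card : ℤ) := by positivity
    simp only [pd, insert_empty_eq, Finset.card_singleton] at this ⊢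
    push_cast
    linarith
  have h4 := h0.rk_nonneg (∅ : Finset V)
  linarith

lemma GenericPoint.notMem_dcl {W : Finset V} {x : V} (h : GenericPoint H n m W x)
    (h0 : H.Nonneg n m) (hn : 1 ≤ n) : x ∉ H.dcl n m (W : Set V) := fun hx => by
  have := h0.mem_dcl.1 hx
  rw [GenericPoint] at h
  have : (1 : ℤ) ≤ n := by exact_mod_cast hn
  linarith

/-- Each hyperedge through `x` would lower the predimension of `insert x W` by `m` below the
dimension that genericity demands. -/
lemma GenericPoint.free (h0 : H.Nonneg n m) (hr : r ≠ 0) (hm : 1 ≤ m) (hn : 1 ≤ n) {W : Finset V}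
    (hW : H.FinStrong n m W) {x : V} (h : GenericPoint H n m W x) :
    H.FinStrong n m (insert x W) ∧ ∀ e ⊆ insert x W, e ∈ H.edges → e ⊆ W := by
  have hxW : x ∉ W := fun hx => h.notMem_dcl h0 hn (h0.subset_dcl W hx)
  have h1 := H.pd_union n m W {x}
  have h2 : W ∩ {x} = ∅ := Finset.inter_singleton_of_notMem hxW
  have h3 : W ∪ {x} = insert x W := by rw [Finset.union_comm, Finset.singleton_union]
  rw [h2, h3, pd_empty hr] at h1
  have h4 := h0.rk_le (le_refl (insert x W))
  have h5 : H.pd n m {x} = n - m * ((H.edgesIn {x}).card : ℤ) := by simp [pd]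
  rw [h0.finStrong_iff_rk] at hW
  rw [GenericPoint] at h
  have h6 : (0 : ℤ) ≤ m * ((H.crossing W {x}).card : ℤ) := by positivity
  have h7 : (0 : ℤ) ≤ m * ((H.edgesIn {x}).card : ℤ) := by positivity
  have hm0 : m ≠ 0 := by omega
  have h8 : (m : ℤ) * ((H.crossing W {x}).card : ℤ) = 0 := by linarith
  have h9 : (m : ℤ) * ((H.edgesIn {x}).card : ℤ) = 0 := by linarith
  have h8 : H.crossing W {x} = ∅ := by simpa [hm0] using h8
  have h9 : H.edgesIn {x} = ∅ := by simpa [hm0] using h9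
  refine ⟨h0.finStrong_iff_rk.2 (by linarith), fun e he hee => ?_⟩
  by_contra heW
  by_cases hex : e ⊆ {x}
  · have : e ∈ H.edgesIn {x} := mem_edgesIn.2 ⟨hex, hee⟩
    rw [h9] at this
    exact Finset.notMem_empty _ this
  · have : e ∈ H.crossing W {x} := mem_crossing.2 ⟨hee, by rwa [h3], heW, hex⟩
    rw [h8] at this
    exact Finset.notMem_empty _ this

/-- Generic points over a finite strong set are conjugate over its `d`-closure. -/
lemma GenericPoint.conj (hH : H.IsGeneric n m) (hr : r ≠ 0) (hm : 1 ≤ m) (hn : 1 ≤ n)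
    {W : Finset V} (hW : H.FinStrong n m W) {x y : V} (hx : GenericPoint H n m W x)
    (hy : GenericPoint H n m W y) :
    ∃ k ∈ H.autFixing (H.dcl n m (W : Set V)), k x = y := by
  have h0 : H.Nonneg n m := (inC0_iff hr).1 hH.inC0
  have hxW := hx.notMem_dcl h0 hn
  have hyW := hy.notMem_dcl h0 hn
  obtain ⟨sx, ex⟩ := hx.free h0 hr hm hn hW
  obtain ⟨sy, ey⟩ := hy.free h0 hr hm hn hW
  set f : V → V := fun v => if v = x then y else v with hf
  have hfx : f x = y := by simp [hf]
  have hfW : ∀ v ∈ W, f v = v := fun v hv => by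
    have : v ≠ x := by rintro rfl; exact hxW (h0.subset_dcl W hv)
    simp [hf, this]
  have him : (insert x W).image f = insert y W := by
    rw [Finset.image_insert, hfx, image_eq_self_of_fix hfW]
  have hpa : PartialAut H n m W (insert x W) f := by
    refine ⟨Finset.subset_insert _ _, sx, by rwa [him], ⟨?_, ?_⟩, ?_⟩
    · intro u hu v hv huv
      rw [Finset.mem_coe, Finset.mem_insert] at hu hv
      rcases hu with rfl | hu <;> rcases hv with rfl | hv
      · rfl
      · rw [hfx, hfW v hv] at huv
        exact absurd (h0.subset_dcl W hv) (huv ▸ hyW)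
      · rw [hfx, hfW u hu] at huv
        exact absurd (h0.subset_dcl W hu) (huv ▸ hyW)
      · rwa [hfW u hu, hfW v hv] at huv
    · intro e he
      by_cases heW : e ⊆ W
      · rw [image_eq_self_of_fix fun v hv => hfW v (heW hv)]
      · refine iff_of_false (fun hee => ?_) (fun hee => heW (ex e he hee))
        have h1 := ey _ (him ▸ Finset.image_subset_image he) hee
        have hxe : x ∈ e := by
          by_contra hxe
          exact heW fun v hv => (Finset.mem_insert.1 (he hv)).resolve_left
            (by rintro rfl; exact hxe hv)
        have h2 := h1 (Finset.mem_image_of_mem f hxe)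
        rw [hfx] at h2
        exact hyW (h0.subset_dcl W h2)
    · intro v hv hvW
      rcases Finset.mem_insert.1 hv with rfl | hv
      · exact absurd hvW hxW
      · exact hfW v hv
  obtain ⟨k, hk, hkf⟩ := hpa.exists_autFixing hH hr hm
  exact ⟨k, hk, by rw [hkf x (Finset.mem_insert_self _ _), hfx]⟩

/-- Adding one `U i` costs at most `c`, since the overlap contains `Z` and so has predimension at
least `d(Z)`. -/
lemma pd_union_biUnion_le (h0 : H.Nonneg n m) {ι : Type*} {Z C : Finset V} {U : ι → Finset V}
    {c : ℤ} (s : Finset ι) (hZC : Z ⊆ C) (hC : H.pd n m C = H.rk n m Z) (hZU : ∀ i ∈ s, Z ⊆ U i)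
    (hU : ∀ i ∈ s, H.pd n m (U i) ≤ H.rk n m Z + c) :
    H.pd n m (C ∪ s.biUnion U) ≤ H.rk n m Z + s.card * c := by
  classical
  induction s using Finset.induction_on with
  | empty => simp [hC]
  | insert i s hi ih =>
    have h1 := ih (fun j hj => hZU j (Finset.mem_insert_of_mem hj))
      (fun j hj => hU j (Finset.mem_insert_of_mem hj))
    have h2 := hU i (Finset.mem_insert_self i s)
    have h3 := H.pd_submodular n m (C ∪ s.biUnion U) (U i)
    have h4 := h0.rk_le (Finset.subset_inter (hZC.trans Finset.subset_union_left)
      (hZU i (Finset.mem_insert_self i s)) : Z ⊆ (C ∪ s.biUnion U) ∩ U i)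
    have h5 : C ∪ (insert i s).biUnion U = (C ∪ s.biUnion U) ∪ U i := by
      rw [Finset.biUnion_insert]
      ext x
      simp only [Finset.mem_union]
      tauto
    rw [h5, Finset.card_insert_of_notMem hi]
    push_cast
    linarith

/-- If the dimension count leaves room for a single hyperedge across `A` and `U`, then an
automorphism mapping it to a hyperedge across `A` and `U` preserves it. -/
lemma Nonneg.image_eq_of_crossing (h0 : H.Nonneg n m) (hm : 1 ≤ m) {g : Equiv.Perm V}
    (hg : g ∈ H.aut) {Z A U e : Finset V} {c : ℤ} (hZA : Z ⊆ A) (hA : H.FinStrong n m A)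
    (hZU : Z ⊆ U) (hU : H.pd n m U ≤ H.rk n m Z + c)
    (hAU : H.rk n m A + c - m ≤ H.rk n m (A ∪ U)) (he : e ∈ H.edges) (heAU : e ⊆ A ∪ U)
    (heA : ¬ e ⊆ A) (heU : ¬ e ⊆ U) (hge : e.image g ⊆ A ∪ U)
    (ha : ∃ a ∈ e, g a ∈ A ∧ g a ∉ H.dcl n m (Z : Set V))
    (hu : ∃ a ∈ e, g a ∈ U ∧ g a ∉ H.dcl n m (Z : Set V)) :
    e.image g = e ∧ ∀ v ∈ A, v ∈ U → v ∈ H.dcl n m (Z : Set V) := by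
  have h1 := H.pd_union n m A U
  have h2 := h0.rk_le (Finset.subset_inter hZA hZU)
  have h3 := h0.rk_le (le_refl (A ∪ U))
  rw [h0.finStrong_iff_rk] at hA
  have hec : e ∈ H.crossing A U := mem_crossing.2 ⟨he, heAU, heA, heU⟩
  have h4 : (1 : ℤ) ≤ (H.crossing A U).card := by
    exact_mod_cast Finset.card_pos.2 ⟨e, hec⟩
  have hm' : (1 : ℤ) ≤ m := by exact_mod_cast hm
  have h5 : ((H.crossing A U).card : ℤ) ≤ 1 := by
    by_contra hcon
    have : (m : ℤ) * 2 ≤ m * ((H.crossing A U).card : ℤ) :=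
      mul_le_mul_of_nonneg_left (by linarith) (by linarith)
    linarith
  have h6 : ((H.crossing A U).card : ℤ) = 1 := le_antisymm h5 h4
  rw [h6] at h1
  -- The single crossing hyperedge uses up all the slack `m`, so `A ∩ U` has no dimension over `Z`.
  have hdep : ∀ v ∈ A, v ∈ U → v ∈ H.dcl n m (Z : Set V) := fun v hvA hvU => by
    rw [h0.mem_dcl]
    refine le_antisymm ?_ (h0.rk_mono (Finset.subset_insert _ _))
    refine (h0.rk_le (Finset.insert_subset (Finset.mem_inter.2 ⟨hvA, hvU⟩)
      (Finset.subset_inter hZA hZU))).trans ?_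
    linarith
  refine ⟨?_, hdep⟩
  have hgc : e.image g ∈ H.crossing A U := by
    obtain ⟨a, hae, haA, haZ⟩ := ha
    obtain ⟨b, hbe, hbU, hbZ⟩ := hu
    refine mem_crossing.2 ⟨?_, hge, fun hsub => ?_, fun hsub => ?_⟩
    · exact ((isoOn_of_mem_aut hg e).edges_iff e le_rfl).2 he
    · exact hbZ (hdep _ (hsub (Finset.mem_image_of_mem g hbe)) hbU)
    · exact haZ (hdep _ haA (hsub (Finset.mem_image_of_mem g hae)))
  exact Finset.card_le_one.1 (by exact_mod_cast h5) _ hgc _ hec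

/-- A hyperedge joining a generic point to independent copies of `y`, where the copies of `E ∋ y`
are independent over `W`. -/
lemma IsGeneric.exists_generic_edge (hH : H.IsGeneric n m) (hm : 1 ≤ m)
    (hpar : (r = 2 ∧ m < n) ∨ (3 ≤ r ∧ m ≤ n)) {Z W E : Finset V} {y : V} (hZW : Z ⊆ W)
    (hyE : y ∈ E) (hpos : 1 ≤ H.rk n m (insert y Z) - H.rk n m Z)
    (hbig : (m : ℤ) < ((r : ℤ) - 1) * (H.rk n m (insert y Z) - H.rk n m Z)) :
    ∃ (h : ℕ → Equiv.Perm V) (x : V), (∀ i, h i ∈ H.autFixing (H.dcl n m (Z : Set V))) ∧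
      GenericPoint H n m W x ∧
      insert x ((Finset.range (r - 1)).image fun i => h i y) ∈ H.edges ∧
      (∀ i < r - 1, h i y ∉ H.dcl n m (W : Set V)) ∧
      (∀ i < r - 1, x ∉ H.dcl n m ((W ∪ E.image (h i) : Finset V) : Set V)) ∧
      H.rk n m W + n + ((r : ℤ) - 1) * (H.rk n m (E ∪ Z) - H.rk n m Z) - m
        ≤ H.rk n m (insert x (W ∪ (Finset.range (r - 1)).biUnion fun i => E.image (h i))) := by
  have hr0 : r ≠ 0 := by omega
  have : Nonempty V := ⟨y⟩
  have h0 : H.Nonneg n m := (inC0_iff hr0).1 hH.inC0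
  obtain ⟨h, hfix, hind⟩ := hH.exists_copies hr0 hm hZW E (r - 1)
  have hr1 : ((r - 1 : ℕ) : ℤ) = (r : ℤ) - 1 := by
    rw [Nat.cast_sub (by omega), Nat.cast_one]
  set N := r - 1 with hN
  set κ := H.rk n m (insert y Z) - H.rk n m Z with hκ
  set κE := H.rk n m (E ∪ Z) - H.rk n m Z with hκE
  have hyκ : H.rk n m ({y} ∪ Z) - H.rk n m Z = κ := by rw [Finset.singleton_union]
  -- lower bounds for sets containing some copies of `y`
  have hlower : ∀ J ⊆ Finset.range N, ∀ P : Finset V, W ⊆ P → (∀ j ∈ J, h j y ∈ P) →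
      H.rk n m W + J.card * κ ≤ H.rk n m P := by
    intro J hJ P hWP hP
    have h1 := hind (fun i => if i ∈ J then {y} else ∅) (fun i => by
      by_cases hi : i ∈ J <;> simp [hi, hyE])
    have h2 : ∑ i ∈ Finset.range N,
        (H.rk n m ((if i ∈ J then {y} else ∅) ∪ Z) - H.rk n m Z) = J.card * κ := by
      have : ∀ i ∈ Finset.range N,
          (H.rk n m ((if i ∈ J then {y} else ∅) ∪ Z) - H.rk n m Z) = if i ∈ J then κ else 0 := by
        intro i _
        by_cases hi : i ∈ J <;> simp [hi, hκ]
      rw [Finset.sum_congr rfl this, ← Finset.sum_filter, Finset.sum_const,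
        Finset.filter_mem_eq_inter, Finset.inter_eq_right.2 hJ, nsmul_eq_mul]
    rw [h2] at h1
    refine h1.trans (h0.rk_mono (Finset.union_subset hWP ?_))
    intro x hx
    obtain ⟨i, -, hi⟩ := Finset.mem_biUnion.1 hx
    by_cases hiJ : i ∈ J
    · simp only [hiJ, if_true, Finset.image_singleton, Finset.mem_singleton] at hi
      rw [hi]
      exact hP i hiJ
    · simp [hiJ] at hi
  have hlowerE : ∀ i < N, ∀ P : Finset V, W ∪ E.image (h i) ⊆ P → (∀ j < N, h j y ∈ P) →
      H.rk n m (W ∪ E.image (h i)) + ((N : ℤ) - 1) * κ ≤ H.rk n m P := by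
    intro i hi P hWP hP
    have h1 := hind (fun j => if j = i then E else {y}) (fun j => by
      by_cases hj : j = i <;> simp [hj, hyE])
    have h2 : ∑ j ∈ Finset.range N,
        (H.rk n m ((if j = i then E else {y}) ∪ Z) - H.rk n m Z) = κE + ((N : ℤ) - 1) * κ := by
      have : ∀ j ∈ Finset.range N,
          (H.rk n m ((if j = i then E else {y}) ∪ Z) - H.rk n m Z)
            = (if j = i then κE - κ else 0) + κ := by
        intro j _
        by_cases hj : j = i <;> simp [hj, hκ, hκE]
      rw [Finset.sum_congr rfl this, Finset.sum_add_distrib, Finset.sum_ite_eq',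
        if_pos (Finset.mem_range.2 hi), Finset.sum_const, Finset.card_range, nsmul_eq_mul]
      ring
    rw [h2] at h1
    have h3 := h0.rk_diff_anti (E.image (h i)) hZW
    rw [h0.rk_image_union_of_fix (hfix i), Finset.union_comm _ W] at h3
    have h4 := h0.rk_mono (X := W ∪ (Finset.range N).biUnion fun j =>
      (if j = i then E else {y}).image (h j)) (Y := P) (by
        refine Finset.union_subset (Finset.subset_union_left.trans hWP) ?_
        intro x hx
        obtain ⟨j, hj, hx⟩ := Finset.mem_biUnion.1 hx
        by_cases hji : j = i
        · simp only [hji, if_true] at hx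
          exact hWP (Finset.mem_union_right _ hx)
        · simp only [hji, if_false, Finset.image_singleton, Finset.mem_singleton] at hx
          rw [hx]
          exact hP j (Finset.mem_range.1 hj))
    linarith
  have hyW : ∀ i < N, h i y ∉ H.dcl n m (W : Set V) := by
    intro i hi hcon
    have h1 := hlower {i} (by simpa using hi) (insert (h i y) W) (Finset.subset_insert _ _)
      (by simp)
    rw [h0.mem_dcl.1 hcon, Finset.card_singleton] at h1
    push_cast at h1
    linarith
  have hyinj : Set.InjOn (fun i => h i y) (Finset.range N : Finset ℕ) := by
    intro i hi j hj hij
    have hij : h i y = h j y := hij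
    by_contra hne
    have h1 := hlower {i, j} (by
      intro x hx
      rcases Finset.mem_insert.1 hx with rfl | hx
      · exact hi
      · rw [Finset.mem_singleton.1 hx]; exact hj) (insert (h i y) W) (Finset.subset_insert _ _)
      (by simp [hij])
    rw [Finset.card_pair hne] at h1
    have h2 := h0.rk_diff_insert_anti (h i y) hZW
    have h3 := h0.rk_image_union_of_fix (hfix i) {y}
    rw [Finset.image_singleton, Finset.singleton_union, Finset.singleton_union] at h3
    push_cast at h1
    linarith
  set Q := (Finset.range N).biUnion fun i => E.image (h i) with hQ
  set L := (Finset.range N).image fun i => h i y with hL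
  have hLcard : L.card = N := by rw [hL, Finset.card_image_of_injOn hyinj, Finset.card_range]
  have hEQ : ∀ i < N, E.image (h i) ⊆ Q := fun i hi =>
    Finset.subset_biUnion_of_mem (fun i => E.image (h i)) (Finset.mem_range.2 hi)
  have hLQ : L ⊆ Q := by
    intro v hv
    obtain ⟨i, hi, rfl⟩ := Finset.mem_image.1 hv
    exact hEQ i (Finset.mem_range.1 hi) (Finset.mem_image_of_mem _ hyE)
  have hQr : H.rk n m W + N * κE ≤ H.rk n m (W ∪ Q) := by
    have := hind (fun _ => E) (fun _ => le_rfl)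
    simpa [hκE, mul_sub] using this
  obtain ⟨D, hD, hDs, -⟩ := h0.exists_cl0 (W ∪ Q)
  obtain ⟨hWD, hQD⟩ := Finset.union_subset_iff.1 hD
  set ε : Finset (V ⊕ Unit) := L.disjSum {()} with hε
  have hfilt : ∀ (p : Finset (V ⊕ Unit) → Prop) [DecidablePred p],
      ((({ε} : Finset (Finset (V ⊕ Unit))).filter p).card : ℤ) ≤ 1 := fun p _ => by
    exact_mod_cast (Finset.card_filter_le _ _).trans (Finset.card_singleton ε).le
  have hmn : (m : ℤ) ≤ n := by
    have : m ≤ n := by omega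
    exact_mod_cast this
  have hεsub : ε ⊆ D.disjSum {()} := Finset.disjSum_mono (hLQ.trans hQD) le_rfl
  obtain ⟨β, hβ⟩ := hH.adjoin hr0 hDs {()} {ε}
    (by
      intro e he
      rw [Finset.mem_singleton.1 he, Finset.card_disjSum, hLcard, Finset.card_singleton]
      omega)
    (by
      intro e he
      exact ⟨(), by simp [Finset.mem_singleton.1 he, hε]⟩)
    (by
      intro T hT
      rcases Finset.subset_singleton_iff.1 hT with rfl | rfl
      · rw [Finset.filter_false_of_mem]
        · simp
        · intro e he
          rw [Finset.mem_singleton.1 he]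
          simp [hε]
      · have := mul_le_mul_of_nonneg_left (hfilt (fun e => e.toRight ⊆ {()}))
          (Int.natCast_nonneg m)
        rw [Finset.card_singleton]
        push_cast
        linarith)
  set x := β () with hx
  have hxim : ({()} : Finset Unit).image β = {x} := by simp [hx]
  -- dimension of sets containing `x`
  have hbound : ∀ (X : Finset V) (c : ℤ), X ⊆ D →
      (∀ P : Finset V, X ⊆ P → c ≤ H.rk n m P + n) →
      (∀ P : Finset V, X ⊆ P → L ⊆ P → c ≤ H.rk n m P + n - m) →
      c ≤ H.rk n m (insert x X) := by
    intro X c hXD h1 h2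
    refine hβ.le_rk h0 ?_ fun P hP T hT hsub => ?_
    · rw [hxim, Finset.insert_eq, Finset.union_comm]
      exact Finset.union_subset_union_left hXD
    have hT1 : T = {()} := subset_antisymm hT (by
      rw [Finset.singleton_subset_iff]
      exact hβ.mem_of_mem_union hP hT (Finset.mem_singleton_self _)
        (hsub (Finset.mem_insert_self _ _)))
    have hXP : X ⊆ P := fun v hv => hβ.mem_of_mem_union_left hT (hXD hv)
      (hsub (Finset.mem_insert_of_mem hv))
    subst hT1
    have h3 := h0.rk_le (le_refl P)
    rw [Finset.card_singleton]
    by_cases hLP : L ⊆ P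
    · have h4 := h2 P hXP hLP
      have h5 := mul_le_mul_of_nonneg_left (hfilt (fun e => e ⊆ P.disjSum {()}))
        (Int.natCast_nonneg m)
      push_cast
      linarith
    · have h4 := h1 P hXP
      rw [Finset.filter_false_of_mem, Finset.card_empty]
      · push_cast
        linarith
      · intro e he hsub
        rw [Finset.mem_singleton.1 he] at hsub
        refine hLP fun v hv => ?_
        simpa using hsub (Finset.inl_mem_disjSum.2 hv : Sum.inl v ∈ ε)
  have hLmem : ∀ P : Finset V, L ⊆ P → ∀ j < N, h j y ∈ P := fun P hLP j hj =>
    hLP (Finset.mem_image_of_mem _ (Finset.mem_range.2 hj))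
  refine ⟨h, x, hfix, ?_, ?_, hyW, ?_, ?_⟩
  · refine le_antisymm (h0.rk_insert_le x W) (hbound W _ hWD (fun P hWP => ?_)
      (fun P hWP hLP => ?_))
    · have := h0.rk_mono hWP
      linarith
    · have h1 := hlower (Finset.range N) le_rfl P hWP
        (fun j hj => hLmem P hLP j (Finset.mem_range.1 hj))
      rw [Finset.card_range, hr1] at h1
      linarith
  · have h1 := hβ.image_mem_edges (Finset.mem_singleton_self ε) hεsub
    rw [hε, image_disjSum_elim, hxim, Finset.union_comm, Finset.singleton_union] at h1
    exact h1
  · intro i hi hcon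
    have h1 := hbound (W ∪ E.image (h i)) (H.rk n m (W ∪ E.image (h i)) + 1)
      (Finset.union_subset hWD ((hEQ i hi).trans hQD)) (fun P hP => ?_) (fun P hP hLP => ?_)
    · rw [h0.mem_dcl.1 hcon] at h1
      linarith
    · have h2 := h0.rk_mono hP
      have : (1 : ℤ) ≤ m := by exact_mod_cast hm
      linarith
    · have h2 := hlowerE i hi P hP (hLmem P hLP)
      rw [hr1] at h2
      -- With `x` costing `n - m` and the other copies `(r - 2) κ`, positivity comes from `m < n`
      -- when `r = 2`, and from the other copies when `r ≥ 3`.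
      rcases hpar with ⟨hr, hlt⟩ | ⟨hr, -⟩
      · have : (m : ℤ) + 1 ≤ n := by exact_mod_cast hlt
        have h3 : ((r : ℤ) - 1 - 1) * κ = 0 := by rw [show (r : ℤ) - 1 - 1 = 0 by omega, zero_mul]
        linarith
      · have h3 : (3 : ℤ) ≤ r := by exact_mod_cast hr
        nlinarith
  · rw [← hr1]
    refine hbound (W ∪ Q) _ hD (fun P hP => ?_) (fun P hP _ => ?_)
    · have := h0.rk_mono hP
      have : (0 : ℤ) ≤ m := by positivity
      linarith
    · have := h0.rk_mono hP
      linarith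

end GenericPoints

/-! ### Generic points are fixed, and they determine everything. -/

section Fixing

variable {r : ℕ} {V : Type*} {H : UHypergraph r V} {n m : ℕ} [DecidableEq V]

/-- A reached point of large dimension forces `g` to fix the generic points over large sets. -/
theorem IsGeneric.apply_eq_of_genericPoint (hH : H.IsGeneric n m) (hm : 1 ≤ m)
    (hpar : (r = 2 ∧ m < n) ∨ (3 ≤ r ∧ m ≤ n)) {g : Equiv.Perm V} (hg : g ∈ H.aut)
    {Z W : Finset V} {y : V} (hy : Reached H n m g Z y)
    (hpos : 1 ≤ H.rk n m (insert y Z) - H.rk n m Z)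
    (hbig : (m : ℤ) < ((r : ℤ) - 1) * (H.rk n m (insert y Z) - H.rk n m Z))
    (hW : H.FinStrong n m W) (hZW : Z ∪ Z.image g ⊆ W) (hZW' : Z ∪ Z.image g ⊆ W.image g)
    {x : V} (hx : GenericPoint H n m W x) : g x = x := by
  have hr0 : r ≠ 0 := by omega
  have h0 : H.Nonneg n m := (inC0_iff hr0).1 hH.inC0
  obtain ⟨S, hS, hyS⟩ := hy
  set E := insert y S with hE
  have hyE : y ∈ E := Finset.mem_insert_self _ _
  have hZW1 : Z ⊆ W := Finset.subset_union_left.trans hZW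
  obtain ⟨h, x₁, hfix, hx₁, hedge, hyW, hxU, hrk⟩ :=
    hH.exists_generic_edge hm hpar hZW1 hyE hpos hbig
  have hr1 : ((r - 1 : ℕ) : ℤ) = (r : ℤ) - 1 := by
    rw [Nat.cast_sub (by omega), Nat.cast_one]
  have hn : 1 ≤ n := by omega
  set N := r - 1 with hN
  set κ := H.rk n m (insert y Z) - H.rk n m Z with hκ
  set κE := H.rk n m (E ∪ Z) - H.rk n m Z with hκE
  set Q := (Finset.range N).biUnion fun i => E.image (h i) with hQ
  -- move the configuration to `x`, independently from `g x`
  obtain ⟨k₁, hk₁, hkx⟩ := hx₁.conj hH hr0 hm hn hW hx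
  obtain ⟨k₂, hk₂, hind⟩ := hH.exists_indep hr0 hm (insert x W) (Q.image k₁) {g x}
  have hk₂W := autFixing_mono (h0.dcl_mono_of_subset (Finset.subset_insert x W)) hk₂
  have hk₂x : k₂ x = x := hk₂.2 x (h0.subset_dcl (insert x W) (Finset.mem_insert_self _ _))
  set k := k₂ * k₁ with hk
  have hkW : k ∈ H.autFixing (H.dcl n m (W : Set V)) := mul_mem hk₂W hk₁
  have hkx₁ : k x₁ = x := by rw [hk, Equiv.Perm.mul_apply, hkx, hk₂x]
  have hWk : W.image k = W := image_eq_self_of_fix fun v hv => hkW.2 v (h0.subset_dcl W hv)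
  set h' : ℕ → Equiv.Perm V := fun i => k * h i with hh'
  have hfix' : ∀ i, h' i ∈ H.autFixing (H.dcl n m (Z : Set V)) := fun i =>
    mul_mem (autFixing_mono (h0.dcl_mono_of_subset hZW1) hkW) (hfix i)
  have himE : ∀ i, E.image (h' i) = (E.image (h i)).image k := fun i => by
    rw [Finset.image_image]; rfl
  have himQ : Q.image k = (Finset.range N).biUnion fun i => E.image (h' i) := by
    rw [hQ, Finset.biUnion_image]
    exact Finset.biUnion_congr rfl fun i _ => (himE i).symm
  set e := insert x ((Finset.range N).image fun i => h' i y) with he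
  have hee : e ∈ H.edges := by
    have h1 := ((isoOn_of_mem_aut hkW.1 _).edges_iff _ le_rfl).2 hedge
    rw [Finset.image_insert, hkx₁, Finset.image_image] at h1
    exact h1
  have hyW' : ∀ i < N, h' i y ∉ H.dcl n m (W : Set V) := fun i hi hcon => hyW i hi (by
    rw [← h0.mem_dcl_image hkW.1, hWk]
    exact hcon)
  have hxU' : ∀ i < N, x ∉ H.dcl n m ((W ∪ E.image (h' i) : Finset V) : Set V) :=
    fun i hi hcon => hxU i hi (by
      rw [← h0.mem_dcl_image hkW.1, Finset.image_union, hWk, hkx₁, ← himE]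
      exact hcon)
  have hxW := hx.notMem_dcl h0 hn
  set Z₂ := Z ∪ Z.image g with hZ₂
  have hgW : ∀ v, v ∉ H.dcl n m (W : Set V) → g v ∉ H.dcl n m (Z₂ : Set V) := fun v hv hcon =>
    hv (by
      rw [← h0.mem_dcl_image hg]
      exact h0.dcl_mono_of_subset hZW' hcon)
  -- the two sides of the amalgam
  obtain ⟨A, hA, hAs, hAr, -⟩ := h0.exists_cl0 ({g x} ∪ insert x W)
  have hgxA : g x ∈ A := hA (by simp)
  have hxA : x ∈ A := hA (by simp)
  have hWA : W ⊆ A := fun v hv => hA (by simp [hv])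
  obtain ⟨C, hC, -, hCr, -⟩ := h0.exists_cl0 Z₂
  -- Control places the `g`-image of the `i`-th copy of `E` in the `d`-closure of that copy over
  -- `Z₂`, so closing off with the image costs no extra dimension.
  have hU : ∀ i, ∃ U : Finset V, (Z₂ ∪ E.image (h' i)) ∪ (E.image (h' i)).image g ⊆ U ∧
      (U : Set V) ⊆ H.dcl n m ((Z₂ ∪ E.image (h' i) : Finset V) : Set V) ∧
      H.pd n m U ≤ H.rk n m Z₂ + κE := by
    intro i
    obtain ⟨U, hU, hUs, hUr, -⟩ := h0.exists_cl0 ((Z₂ ∪ E.image (h' i)) ∪ (E.image (h' i)).image g)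
    have hSE : S.image (h' i) ⊆ E.image (h' i) :=
      Finset.image_subset_image (Finset.subset_insert _ _)
    have hgS : ∀ s ∈ S, g (h' i s) ∈ H.dcl n m ((Z₂ ∪ E.image (h' i) : Finset V) : Set V) :=
      fun s hs => h0.dcl_mono_of_subset (Finset.insert_subset
        (Finset.mem_union_right _ (hSE (Finset.mem_image_of_mem _ hs)))
        (Finset.subset_union_left.trans Finset.subset_union_left)) (hS s hs _ (hfix' i))
    have hgE : (((E.image (h' i)).image g : Finset V) : Set V)
        ⊆ H.dcl n m ((Z₂ ∪ E.image (h' i) : Finset V) : Set V) := by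
      intro v hv
      obtain ⟨w, hw, rfl⟩ := Finset.mem_image.1 (Finset.mem_coe.1 hv)
      obtain ⟨z, hz, rfl⟩ := Finset.mem_image.1 hw
      -- The copy of `y` depends on `Z` and the copy of `S`; hence its image depends on `Z.image g`,
      -- which is part of `Z₂`, and on the images of the controlled points.
      rcases Finset.mem_insert.1 hz with rfl | hz
      · have h1 := h0.image_mem_dcl_of_fix (hfix' i) hyS
        rw [← h0.mem_dcl_image hg] at h1
        refine h0.dcl_mono ?_ h1
        intro v hv
        obtain ⟨w, hw, rfl⟩ := Finset.mem_image.1 (Finset.mem_coe.1 hv)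
        rcases Finset.mem_union.1 hw with hw | hw
        · exact h0.subset_dcl _ (Finset.mem_union_left _
            (Finset.mem_union_right _ (Finset.mem_image_of_mem g hw)))
        · obtain ⟨s, hs, rfl⟩ := Finset.mem_image.1 hw
          exact hgS s hs
      · exact hgS z hz
    have h1 := h0.subset_dcl_iff.1 hgE
    have h2 := h0.rk_diff_anti (E.image (h' i)) (Finset.subset_union_left : Z ⊆ Z₂)
    rw [h0.rk_image_union_of_fix (hfix' i), Finset.union_comm _ Z₂] at h2
    refine ⟨U, hU, ?_, by linarith⟩
    rw [h0.subset_dcl_iff, Finset.union_eq_right.2 (Finset.subset_union_left.trans hU),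
      h0.finStrong_iff_rk.1 hUs, hUr, h1]
  choose U hU1 hU2 hU3 using hU
  set UU := C ∪ (Finset.range N).biUnion U with hUU
  have hUsub : ∀ i < N, U i ⊆ UU := fun i hi =>
    (Finset.subset_biUnion_of_mem U (Finset.mem_range.2 hi)).trans Finset.subset_union_right
  have hEU : ∀ i < N, E.image (h' i) ⊆ UU := fun i hi =>
    ((Finset.subset_union_right.trans Finset.subset_union_left).trans (hU1 i)).trans (hUsub i hi)
  have hyU : ∀ i < N, h' i y ∈ UU := fun i hi => hEU i hi (Finset.mem_image_of_mem _ hyE)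
  have hgyU : ∀ i < N, g (h' i y) ∈ UU := fun i hi => hUsub i hi (hU1 i (Finset.mem_union_right _
    (Finset.mem_image_of_mem g (Finset.mem_image_of_mem _ hyE))))
  have hpdU : H.pd n m UU ≤ H.rk n m Z₂ + N * κE := by
    have := pd_union_biUnion_le h0 (Z := Z₂) (C := C) (U := U) (c := κE) (Finset.range N) hC hCr
      (fun i _ => (Finset.subset_union_left.trans Finset.subset_union_left).trans (hU1 i))
      (fun i _ => hU3 i)
    rwa [Finset.card_range] at this
  -- Independence from `g x` over `x` and `W` carries the count for the original configuration over
  -- to `A`; the one hyperedge costs `m`.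
  have hQA : H.rk n m A + N * κE - m ≤ H.rk n m (A ∪ Q.image k) := by
    have h1 : (Q.image k₁).image k₂ = Q.image k := by rw [Finset.image_image]; rfl
    have h2 : H.rk n m (Q.image k₁ ∪ insert x W) = H.rk n m (insert x₁ (W ∪ Q)) := by
      rw [← h0.rk_image_aut hk₁.1 (insert x₁ (W ∪ Q)), Finset.image_insert, hkx,
        Finset.image_union,
        image_eq_self_of_fix (Z := W) fun v hv => hk₁.2 v (h0.subset_dcl W hv)]
      congr 1
      ext v
      simp only [Finset.mem_union, Finset.mem_insert]
      tauto
    rw [h1, h2] at hind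
    have h3 : H.rk n m A = H.rk n m ({g x} ∪ insert x W) := by
      rw [h0.finStrong_iff_rk.1 hAs, hAr]
    have h4 := h0.rk_mono (X := Q.image k ∪ {g x} ∪ insert x W) (Y := A ∪ Q.image k) (by
      rw [Finset.union_assoc, Finset.union_comm]
      exact Finset.union_subset_union_left hA)
    rw [GenericPoint] at hx
    rw [← hr1] at hrk
    linarith
  have hQU : Q.image k ⊆ UU := by
    rw [himQ]
    exact Finset.biUnion_subset.2 fun i hi => hEU i (Finset.mem_range.1 hi)
  have hN1 : 0 < N := by omega
  have hxUU : x ∉ UU := by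
    rw [hUU, Finset.mem_union, not_or]
    constructor
    · intro hcon
      have h1 : (C : Set V) ⊆ H.dcl n m (Z₂ : Set V) := by
        rw [h0.subset_dcl_iff, Finset.union_eq_right.2 hC]
        exact le_antisymm (hCr ▸ h0.rk_le le_rfl) (h0.rk_mono hC)
      exact hxW (h0.dcl_mono_of_subset hZW (h1 hcon))
    · intro hcon
      obtain ⟨i, hi, hxi⟩ := Finset.mem_biUnion.1 hcon
      exact hxU' i (Finset.mem_range.1 hi)
        (h0.dcl_mono_of_subset (Finset.union_subset_union_left hZW) (hU2 i hxi))
  have hmem_e : ∀ i < N, h' i y ∈ e := fun i hi => Finset.mem_insert_of_mem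
    (Finset.mem_image_of_mem (fun i => h' i y) (Finset.mem_range.2 hi))
  have hxe : x ∈ e := Finset.mem_insert_self _ _
  -- If `A` contained all copies of `y`, the rank gained from `Q` would drop by `N * κ`, more than
  -- the `m` allowed by `hQA`.
  have heA : ¬ e ⊆ A := by
    intro hsub
    have h1 := h0.rk_union_biUnion_le (s := Finset.range N) (P := A) (hZW1.trans hWA)
      (E := fun i => E.image (h' i)) (F := fun i => ({y} : Finset V).image (h' i))
      (fun i _ => Finset.image_subset_image (Finset.singleton_subset_iff.2 hyE))
      (fun i hi => by
        rw [Finset.image_singleton, Finset.singleton_subset_iff]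
        exact hsub (hmem_e i (Finset.mem_range.1 hi)))
    rw [← himQ] at h1
    have h2 : ∀ i ∈ Finset.range N, (H.rk n m (E.image (h' i) ∪ Z)
        - H.rk n m (({y} : Finset V).image (h' i) ∪ Z)) = κE - κ := fun i _ => by
      rw [h0.rk_image_union_of_fix (hfix' i), h0.rk_image_union_of_fix (hfix' i),
        Finset.singleton_union]
      ring
    rw [Finset.sum_congr rfl h2, Finset.sum_const, Finset.card_range, nsmul_eq_mul] at h1
    rw [← hr1] at hbig
    linarith
  obtain ⟨h1, h2⟩ := h0.image_eq_of_crossing hm hg (Z := Z₂) (A := A) (U := UU) (e := e)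
    (c := N * κE) (hZW.trans hWA) hAs (hC.trans Finset.subset_union_left) hpdU
    (hQA.trans (h0.rk_mono (Finset.union_subset_union_right hQU))) hee
    (by
      refine Finset.insert_subset (Finset.mem_union_left _ hxA) fun v hv => ?_
      obtain ⟨i, hi, rfl⟩ := Finset.mem_image.1 hv
      exact Finset.mem_union_right _ (hyU i (Finset.mem_range.1 hi)))
    heA (fun hsub => hxUU (hsub hxe))
    (by
      intro v hv
      obtain ⟨w, hw, rfl⟩ := Finset.mem_image.1 hv
      rcases Finset.mem_insert.1 hw with rfl | hw
      · exact Finset.mem_union_left _ hgxA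
      · obtain ⟨i, hi, rfl⟩ := Finset.mem_image.1 hw
        exact Finset.mem_union_right _ (hgyU i (Finset.mem_range.1 hi)))
    ⟨x, hxe, hgxA, hgW x hxW⟩ ⟨h' 0 y, hmem_e 0 hN1, hgyU 0 hN1, hgW _ (hyW' 0 hN1)⟩
  -- The other vertices of `e` lie in `U`. If `g x` were one of them it would be in `A ∩ U`, hence
  -- in `cl^d(Z₂)`, which is excluded.
  have h3 : g x ∈ e := h1 ▸ Finset.mem_image_of_mem g hxe
  rcases Finset.mem_insert.1 h3 with h3 | h3
  · exact h3
  · obtain ⟨i, hi, hie⟩ := Finset.mem_image.1 h3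
    exact absurd (h2 (g x) hgxA (hie ▸ hyU i (Finset.mem_range.1 hi))) (hgW x hxW)

/-- If all generic points over a finite set are fixed, then all points are fixed. -/
theorem IsGeneric.eq_one_of_fix_generic (hH : H.IsGeneric n m) (hm : 1 ≤ m)
    (hpar : (r = 2 ∧ m < n) ∨ (3 ≤ r ∧ m ≤ n)) {g : Equiv.Perm V} (hg : g ∈ H.aut)
    {W : Finset V} (hgen : ∀ x, GenericPoint H n m W x → g x = x) : g = 1 := by
  have hr0 : r ≠ 0 := by omega
  have h0 : H.Nonneg n m := (inC0_iff hr0).1 hH.inC0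
  have hr1 : ((r - 1 : ℕ) : ℤ) = (r : ℤ) - 1 := by
    rw [Nat.cast_sub (by omega), Nat.cast_one]
  have hmn : (m : ℤ) + 1 ≤ n * ((r : ℤ) - 1) := by
    have hm' : (1 : ℤ) ≤ m := by exact_mod_cast hm
    rcases hpar with ⟨hr, hlt⟩ | ⟨hr, hle⟩
    · have h1 : (m : ℤ) + 1 ≤ n := by exact_mod_cast hlt
      rw [show (r : ℤ) - 1 = 1 by omega]
      linarith
    · have h1 : (m : ℤ) ≤ n := by exact_mod_cast hle
      have h2 : (3 : ℤ) ≤ r := by exact_mod_cast hr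
      nlinarith
  set N := r - 1 with hN
  -- Induction on the codimension `j` of `a` relative to generic points over `W`.
  have key : ∀ (j : ℕ) (a : V), H.rk n m W + n ≤ H.rk n m (insert a W) + j → g a = a := by
    intro j
    induction j with
    | zero =>
      intro a ha
      refine hgen a (le_antisymm (h0.rk_insert_le a W) ?_)
      push_cast at ha
      linarith
    | succ j ih =>
      intro a ha
      have : Nonempty V := ⟨a⟩
      obtain ⟨A, hA, hAs, -⟩ := h0.exists_cl0 (insert a (insert (g a) W))
      have haA : a ∈ A := hA (Finset.mem_insert_self _ _)
      have hgaA : g a ∈ A := hA (Finset.mem_insert_of_mem (Finset.mem_insert_self _ _))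
      have hWA : W ⊆ A := fun v hv =>
        hA (Finset.mem_insert_of_mem (Finset.mem_insert_of_mem hv))
      -- One hyperedge through `a` and `r - 1` new points. If it is present, the dimension over `W`
      -- exceeds that of `a` by at least `n(r - 1) - m ≥ 1`; otherwise the new points are
      -- unconstrained. Either way the induction hypothesis applies to them.
      set ε : Finset (V ⊕ ℕ) := ({a} : Finset V).disjSum (Finset.range N) with hε
      have hfilt : ∀ (p : Finset (V ⊕ ℕ) → Prop) [DecidablePred p],
          ((({ε} : Finset (Finset (V ⊕ ℕ))).filter p).card : ℤ) ≤ 1 := fun p _ => by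
        exact_mod_cast (Finset.card_filter_le _ _).trans (Finset.card_singleton ε).le
      have hfilt' : ∀ (p : Finset (V ⊕ ℕ) → Prop) [DecidablePred p],
          (m : ℤ) * ((({ε} : Finset (Finset (V ⊕ ℕ))).filter p).card : ℤ) ≤ m := fun p _ => by
        have := mul_le_mul_of_nonneg_left (hfilt p) (Int.natCast_nonneg m)
        linarith
      have hεA : ε ⊆ A.disjSum (Finset.range N) :=
        Finset.disjSum_mono (Finset.singleton_subset_iff.2 haA) le_rfl
      obtain ⟨β, hβ⟩ := hH.adjoin hr0 hAs (Finset.range N) {ε}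
        (by
          intro e he
          rw [Finset.mem_singleton.1 he, Finset.card_disjSum, Finset.card_singleton,
            Finset.card_range]
          omega)
        (by
          intro e he
          exact ⟨0, by
            rw [Finset.mem_singleton.1 he, Finset.inr_mem_disjSum, Finset.mem_range]
            omega⟩)
        (by
          intro T hT
          by_cases hTN : Finset.range N ⊆ T
          · have h1 := hfilt' (fun e => e.toRight ⊆ T)
            rw [subset_antisymm hT hTN] at h1 ⊢
            rw [Finset.card_range, hr1]
            linarith
          · rw [Finset.filter_false_of_mem, Finset.card_empty]
            · positivity
            · intro e he
              rw [Finset.mem_singleton.1 he, hε, Finset.toRight_disjSum]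
              exact hTN)
      have hβfix : ∀ i ∈ Finset.range N, g (β i) = β i := by
        intro i hi
        refine ih (β i) ?_
        rw [← sub_le_iff_le_add]
        refine hβ.le_rk h0 (Finset.insert_subset (Finset.mem_union_right _
          (Finset.mem_image_of_mem β hi)) (hWA.trans Finset.subset_union_left))
          fun P hP T hT hsub => ?_
        have hiT : i ∈ T := hβ.mem_of_mem_union hP hT hi (hsub (Finset.mem_insert_self _ _))
        have hWP : W ⊆ P := fun v hv => hβ.mem_of_mem_union_left hT (hWA hv)
          (hsub (Finset.mem_insert_of_mem hv))
        have hT1 : (1 : ℤ) ≤ T.card := by exact_mod_cast Finset.card_pos.2 ⟨i, hiT⟩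
        have hj : (0 : ℤ) ≤ j := by positivity
        by_cases hεP : ε ⊆ P.disjSum T
        · have haP : a ∈ P := by
            simpa using hεP (Finset.inl_mem_disjSum.2 (Finset.mem_singleton_self a))
          have hNT : Finset.range N ⊆ T := fun v hv => by
            simpa using hεP (Finset.inr_mem_disjSum.2 hv)
          have h1 := h0.rk_le (Finset.insert_subset haP hWP)
          have h2 := hfilt' (fun e => e ⊆ P.disjSum T)
          rw [subset_antisymm hT hNT] at h2 ⊢
          rw [Finset.card_range, hr1]
          push_cast at ha
          linarith
        · rw [Finset.filter_false_of_mem, Finset.card_empty]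
          · have h1 := h0.rk_le hWP
            have h2 : (n : ℤ) * 1 ≤ n * T.card :=
              mul_le_mul_of_nonneg_left hT1 (Int.natCast_nonneg n)
            push_cast
            linarith
          · intro e he
            rw [Finset.mem_singleton.1 he]
            exact hεP
      -- Applying `g` replaces only `a` by `g a`. Since `g a ∈ A`, the result lies within the
      -- adjoined structure, whose only hyperedge meeting the new points is the one through `a`.
      have hedge := hβ.image_mem_edges (Finset.mem_singleton_self ε) hεA
      rw [hε, image_disjSum_elim, ← (isoOn_of_mem_aut hg _).edges_iff _ le_rfl,
        Finset.image_union, Finset.image_singleton, image_eq_self_of_fix (k := g) (fun v hv => by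
          obtain ⟨i, hi, rfl⟩ := Finset.mem_image.1 hv
          exact hβfix i hi), ← image_disjSum_elim, hβ.edges_iff _
          (Finset.disjSum_mono (Finset.singleton_subset_iff.2 hgaA) le_rfl)] at hedge
      rcases hedge with h1 | ⟨e₀, -, h1⟩
      · have h2 := congrArg Finset.toLeft (Finset.mem_singleton.1 h1)
        rw [hε, Finset.toLeft_disjSum, Finset.toLeft_disjSum] at h2
        exact Finset.singleton_injective h2
      · have h2 : Sum.inr 0 ∈ ({g a} : Finset V).disjSum (Finset.range N) :=
          Finset.inr_mem_disjSum.2 (Finset.mem_range.2 (by omega))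
        rw [h1] at h2
        simp at h2
  ext a
  refine key n a ?_
  have := h0.rk_mono (Finset.subset_insert a W)
  linarith

end Fixing

end UHypergraph

/-- In the generic structure `H = M₀` for `(𝒞₀, ≤)`, every bounded automorphism fixing the
`d`-closure of the empty set pointwise is the identity. -/
theorem theorem4p14 {V : Type*} (r n m : ℕ) (hm : 1 ≤ m) (hnm : Nat.Coprime n m)
    (hpar : (r = 2 ∧ m < n) ∨ (3 ≤ r ∧ m ≤ n))
    (H : UHypergraph r V) (hH : H.IsGeneric n m)
    (g : Equiv.Perm V) (hg : g ∈ H.autFixing (H.dcl n m ∅)) (hb : H.IsBounded n m g) :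
    g = 1 := by
  classical
  have hr0 : r ≠ 0 := by omega
  have h0 : H.Nonneg n m := (UHypergraph.inC0_iff hr0).1 hH.inC0
  obtain ⟨Z, s, hs, hsZ⟩ := hH.exists_controlled hr0 hm hg.1 hb
  obtain ⟨y, hy, hpos, hbig⟩ := hH.exists_reached hm hpar hnm hs hsZ
  -- Including the preimage under `g` ensures that both `W` and `W.image g` contain `Z ∪ Z.image g`.
  obtain ⟨W, hW, hWs, -⟩ := h0.exists_cl0
    ((Z ∪ Z.image g) ∪ (Z ∪ Z.image g).image ⇑g⁻¹)
  rw [Finset.union_subset_iff] at hW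
  refine hH.eq_one_of_fix_generic hm hpar hg.1 (W := W) fun x hx =>
    hH.apply_eq_of_genericPoint hm hpar hg.1 hy hpos hbig hWs hW.1 (fun v hv => ?_) hx
  exact Finset.mem_image.2 ⟨g⁻¹ v, hW.2 (Finset.mem_image_of_mem _ hv), by simp⟩
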